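/- Let $c\ge 0$. Let $\Gamma\subset\mathbb R^3$ be a nonempty open cone (that is, $t\Gamma\subset\Gamma$ for all $t>0$) such that $\Gamma^c\setminus\{0\}\neq\emptyset$, where $\Gamma^c=\mathbb R^3\setminus\Gamma$, and suppose that $\partial\Gamma\setminus\{0\}$ is a smooth ($C^\infty$) surface with $\Gamma$ locally on one side of it. Let $H$ be the mean curvature of $\partial\Gamma\setminus\{0\}$, i.e. the sum of the principal curvatures, with the sign for which $H\ge 0$ wherever $\Gamma^c$ is locally convex (equivalently, $H=\operatorname{div} n$, where $n$ is the unit normal pointing into $\Gamma$). Let $$g^{ij}(x)=\delta_{ij}-\frac{c^2}{1+c^2}\,\frac{x_ix_j}{|x|^2},\qquad x\in\mathbb R^3\setminus\{0\},$$ be the inverse metric coefficients of the cone $\{y_4=c\sqrt{y_1^2+y_2^2+y_3^2}\}\subset\mathbb R^4$ in the coordinates $x\mapsto(x,c|x|)$. Suppose that $H\ge 0$ on $\partial\Gamma\setminus\{0\}$ and that $$\int_{\partial\Gamma}H F^2\,d\sigma\;\le\;\int_\Gamma \sum_{i,j=1}^3 g^{ij}\,\partial_iF\,\partial_jF\,dx\qquad\text{for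 every }F\in C_0^\infty(\mathbb R^3\setminus\{0\}),$$ where $d\sigma$ is the Euclidean surface measure and $dx$ is Lebesgue measure. Then $\Gamma^c\setminus\{0\}$ is connected (it has exactly one connected component), and $\Gamma^c$ is a convex cone contained in a closed half space $\{x: x\cdot v\ge 0\}$ for some $v\ne 0$. -/

import Mathlib

open MeasureTheory Topology
open scoped ContDiff Gradient

/-- Euclidean three-space. -/
abbrev E3 : Type := EuclideanSpace ℝ (Fin 3)

/-- A set is a cone if it is invariant under multiplication by positive numbers. -/
def IsCone (S : Set E3) : Prop :=
  ∀ x ∈ S, ∀ t : ℝ, 0 < t → t • x ∈ S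

/-- `ρ` is a local defining function of `Γ` at the boundary point `p`: it is smooth near `p`,
vanishes at `p`, has non-vanishing gradient there, and near `p` the set `Γ` is `{ρ > 0}`. -/
structure IsLocalDefiningFunction (Γ : Set E3) (p : E3) (ρ : E3 → ℝ) : Prop where
  smooth : ∀ᶠ x in 𝓝 p, ContDiffAt ℝ ∞ ρ x
  eq_zero : ρ p = 0
  gradient_ne_zero : ∇ ρ p ≠ 0
  mem_iff : ∀ᶠ x in 𝓝 p, (x ∈ Γ ↔ 0 < ρ x)

/-- Away from the origin, the boundary of `Γ` is a smooth surface with `Γ` on one side of it. -/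
def HasSmoothBoundaryOffOrigin (Γ : Set E3) : Prop :=
  ∀ p ∈ frontier Γ, p ≠ 0 → ∃ ρ : E3 → ℝ, IsLocalDefiningFunction Γ p ρ

/-- The divergence of a vector field on Euclidean three-space. -/
noncomputable def euclideanDiv (X : E3 → E3) (p : E3) : ℝ :=
  ∑ i : Fin 3, (fderiv ℝ X p (EuclideanSpace.single i 1)) i

open Classical in
/-- The mean curvature (sum of the two principal curvatures) of `∂Γ` at the boundary point `p`,
with respect to the unit normal `∇ρ / |∇ρ|` pointing into `Γ`; it is the divergence of that normal
and does not depend on the local defining function `ρ`. With this sign the complement of an open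
ball of radius `R` has mean curvature `2 / R`, so that the mean curvature is nonnegative where the
complement of `Γ` is convex. The value is `0` by convention at points at which `∂Γ` is not a smooth
surface. -/
noncomputable def meanCurvature (Γ : Set E3) (p : E3) : ℝ :=
  if h : ∃ ρ : E3 → ℝ, IsLocalDefiningFunction Γ p ρ then
    euclideanDiv (fun x => ‖∇ h.choose x‖⁻¹ • ∇ h.choose x) p
  else 0

/-- The inverse metric coefficients `g^{ij}` at `x ≠ 0` of the cone `y₄ = c |(y₁, y₂, y₃)|` in
`ℝ⁴`, in the coordinates `x ↦ (x, c |x|)`: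
`g^{ij} = ((1 + c²) |x|² δ_{ij} - c² xᵢ xⱼ) / ((1 + c²) |x|²)`. -/
noncomputable def coneInvMetric (c : ℝ) (x : E3) : Matrix (Fin 3) (Fin 3) ℝ :=
  Matrix.of fun i j =>
    ((1 + c ^ 2) * ‖x‖ ^ 2 * (if i = j then 1 else 0) - c ^ 2 * x i * x j) /
      ((1 + c ^ 2) * ‖x‖ ^ 2)

/-- The partial derivative `∂F / ∂xᵢ`. -/
noncomputable def partialDeriv (i : Fin 3) (F : E3 → ℝ) (x : E3) : ℝ :=
  fderiv ℝ F x (EuclideanSpace.single i 1)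

/-- Smooth functions whose support is a compact subset of `ℝ³ \ {0}`. -/
def IsTestFunctionOffOrigin (F : E3 → ℝ) : Prop :=
  ContDiff ℝ ∞ F ∧ HasCompactSupport F ∧ (0 : E3) ∉ tsupport F

/-- The stability inequality `∫_{∂Γ} H F² dσ ≤ ∫_Γ g^{ij} Fᵢ Fⱼ dx` for all test functions `F`;
`dσ` is Euclidean surface area (the two-dimensional Hausdorff measure, normalized to agree with
area on planes) and `dx` is Lebesgue measure. -/
def SatisfiesStabilityInequality (c : ℝ) (Γ : Set E3) : Prop :=
  ∀ F : E3 → ℝ, IsTestFunctionOffOrigin F →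
    ∫ x in frontier Γ, meanCurvature Γ x * F x ^ 2 ∂(μHE[2] : Measure E3) ≤
      ∫ x in Γ, ∑ i : Fin 3, ∑ j : Fin 3,
        coneInvMetric c x i j * partialDeriv i F x * partialDeriv j F x

/-!
Write `K = Γᶜ`. The heart of the matter is that the interior of `K` has only one component. This
component turns out to be a convex cone, and `K` is its closure.

*Convexity.* Near a boundary point other than the origin the boundary is the cone over the graph
of a function `u` in an affine plane (`exists_boundaryChart`), and its mean curvature is a
negative multiple of `u''` (`BoundaryChart.meanCurvature_eq`). Hence `0 ≤ H` makes `K` locally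
convex away from the origin (`isLocallyConvexOffOrigin_compl`), and by a local-to-global argument
every component of the interior of `K` is an open convex cone (`convex_connectedComponentIn`).

*Sweeping.* Let `U` be such a component and let `x ∈ Γ` with `-x ∉ closure U`. The line through
`x` meets `closure U` at most in the origin, so it lies in two supporting planes of `U`. Each of
them touches `U` along a generator of the boundary cone, and for one of the two, chosen by
orientation, `x` lies on the positive side of that generator, that is, in its open tangent half
plane (`exists_mem_sweep`). If there are two components, almost every `-x` lies outside the
closure of one of them. The tangent half planes then sweep out almost all of `Γ`
(`volume_le_sum_bend`).

*Volume against curvature.* The map `(r, t, s) ↦ r γ(t) + s γ'(t)` that parametrizes the tangent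
half planes has the Jacobian `s |u''(t)|`. So the part of the unit ball that they sweep out has
volume at most about `∫ |u''|`, the bend of the curve
(`BoundaryChart.volume_sweep_inter_ball_le`). For a radial function `f(|x|)` the curvature
integral is about `(∫ |u''| dt) (∫ f² dr)` (`BoundaryChart.bend_mul_le_lintegral`). The errors in
both statements come from the slopes in the charts, which are at most `1 / 100`.

*Contradiction.* The right-hand side of the stability inequality for `f(|x|)` is at most
`3 vol (Γ ∩ B₁) ∫ r² f'² dr`. Hardy's inequality on the half line has the constant `1 / 4`, so there are `f`
with `∫ r² f'² ≤ (3 / 10) ∫ f²` (`exists_hardy_test_function`). With two components this gives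
`vol (Γ ∩ B₁) ≤ 1.03 · 1.05 · 3 · 0.3 · vol (Γ ∩ B₁)`, although the product of the constants is
less than `1` (`connectedComponentIn_interior_compl_eq`).
-/

open Filter Set Metric
open scoped RealInnerProductSpace

/-! ### Frames and triple products -/

/-- The triple product `det (x, y, z)` of three vectors. -/
def tripleProduct (x y z : E3) : ℝ :=
  x 0 * (y 1 * z 2 - y 2 * z 1) - x 1 * (y 0 * z 2 - y 2 * z 0) + x 2 * (y 0 * z 1 - y 1 * z 0)

/-- The vector with coordinates `(x, y, z)` in the frame `b`. -/
noncomputable def frameVec (b : OrthonormalBasis (Fin 3) ℝ E3) (x y z : ℝ) : E3 :=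
  x • b 0 + y • b 1 + z • b 2

section Frames

variable (b : OrthonormalBasis (Fin 3) ℝ E3)

lemma inner_frame (i j : Fin 3) : ⟪b i, b j⟫ = if i = j then 1 else 0 :=
  orthonormal_iff_ite.1 b.orthonormal i j

@[simp] lemma inner_frameVec_zero (x y z : ℝ) : ⟪b 0, frameVec b x y z⟫ = x := by
  simp [frameVec, inner_add_right, inner_smul_right]

@[simp] lemma inner_frameVec_one (x y z : ℝ) : ⟪b 1, frameVec b x y z⟫ = y := by
  simp [frameVec, inner_add_right, inner_smul_right]

@[simp] lemma inner_frameVec_two (x y z : ℝ) : ⟪b 2, frameVec b x y z⟫ = z := by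
  simp [frameVec, inner_add_right, inner_smul_right]

lemma frameVec_inner (x : E3) : frameVec b ⟪b 0, x⟫ ⟪b 1, x⟫ ⟪b 2, x⟫ = x := by
  have := b.sum_repr' x
  rw [Fin.sum_univ_three] at this
  exact this

lemma exists_frameVec (x : E3) : ∃ x₀ x₁ x₂ : ℝ, x = frameVec b x₀ x₁ x₂ :=
  ⟨_, _, _, (frameVec_inner b x).symm⟩

lemma inner_frameVec (x : E3) (p q r : ℝ) :
    ⟪x, frameVec b p q r⟫ = p * ⟪b 0, x⟫ + q * ⟪b 1, x⟫ + r * ⟪b 2, x⟫ := by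
  simp only [frameVec, inner_add_right, inner_smul_right, real_inner_comm]

lemma frameVec_inner_frameVec (x y z p q r : ℝ) :
    ⟪frameVec b x y z, frameVec b p q r⟫ = x * p + y * q + z * r := by
  rw [inner_frameVec]; simp; ring

lemma norm_sq_frameVec (x y z : ℝ) : ‖frameVec b x y z‖ ^ 2 = x ^ 2 + y ^ 2 + z ^ 2 := by
  rw [← real_inner_self_eq_norm_sq, frameVec_inner_frameVec]; ring

lemma smul_frameVec (c x y z : ℝ) : c • frameVec b x y z = frameVec b (c * x) (c * y) (c * z) := by
  simp [frameVec, smul_add, smul_smul]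

lemma frameVec_add (x y z p q r : ℝ) :
    frameVec b x y z + frameVec b p q r = frameVec b (x + p) (y + q) (z + r) := by
  simp only [frameVec, add_smul]; abel

lemma tripleProduct_frameVec (x y z p q r k l m : ℝ)
    (hb : tripleProduct (b 0) (b 1) (b 2) = 1) :
    tripleProduct (frameVec b x y z) (frameVec b p q r) (frameVec b k l m) =
      x * (q * m - r * l) - y * (p * m - r * k) + z * (p * l - q * k) := by
  simp only [tripleProduct, frameVec, PiLp.add_apply, PiLp.smul_apply, smul_eq_mul] at hb ⊢
  linear_combination (x * (q * m - r * l) - y * (p * m - r * k) + z * (p * l - q * k)) * hb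

/-- Two orthogonal unit vectors are the first and the last vector of a positively oriented
orthonormal frame. -/
lemma exists_frame {p n : E3} (hp : ‖p‖ = 1) (hn : ‖n‖ = 1) (hpn : ⟪p, n⟫ = 0) :
    ∃ b : OrthonormalBasis (Fin 3) ℝ E3, b 0 = p ∧ b 2 = n ∧
      tripleProduct (b 0) (b 1) (b 2) = 1 := by
  set m : E3 := !₂[n 1 * p 2 - n 2 * p 1, n 2 * p 0 - n 0 * p 2, n 0 * p 1 - n 1 * p 0] with hm
  have hp' : p 0 * p 0 + p 1 * p 1 + p 2 * p 2 = 1 := by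
    have := EuclideanSpace.real_norm_sq_eq p
    rw [hp, Fin.sum_univ_three] at this
    linarith
  have hn' : n 0 * n 0 + n 1 * n 1 + n 2 * n 2 = 1 := by
    have := EuclideanSpace.real_norm_sq_eq n
    rw [hn, Fin.sum_univ_three] at this
    linarith
  have hpn' : n 0 * p 0 + n 1 * p 1 + n 2 * p 2 = 0 := by
    simpa [PiLp.inner_apply, Fin.sum_univ_three] using hpn
  have hmm : ‖m‖ = 1 := by
    have h : ‖m‖ ^ 2 = 1 := by
      rw [EuclideanSpace.real_norm_sq_eq, Fin.sum_univ_three]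
      simp [hm]
      linear_combination (n 0 * n 0 + n 1 * n 1 + n 2 * n 2) * hp' + hn'
        - (n 0 * p 0 + n 1 * p 1 + n 2 * p 2) * hpn'
    nlinarith [norm_nonneg m]
  have hpm : ⟪p, m⟫ = 0 := by
    simp [PiLp.inner_apply, Fin.sum_univ_three, hm]; ring
  have hmn : ⟪m, n⟫ = 0 := by
    simp [PiLp.inner_apply, Fin.sum_univ_three, hm]; ring
  have hon : Orthonormal ℝ ![p, m, n] := by
    rw [orthonormal_iff_ite]
    intro i j
    fin_cases i <;> fin_cases j <;>
      simp [hp, hn, hmm, hpn, hpm, hmn, real_inner_comm p, real_inner_comm m n]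
  have hsp := hon.linearIndependent.span_eq_top_of_card_eq_finrank (by simp)
  refine ⟨OrthonormalBasis.mk hon hsp.ge, by simp, by simp, ?_⟩
  simp [tripleProduct, hm]
  linear_combination (n 0 * n 0 + n 1 * n 1 + n 2 * n 2) * hp' + hn'
    - (n 0 * p 0 + n 1 * p 1 + n 2 * p 2) * hpn'

end Frames

/-! ### Conical graph charts of the boundary -/

/-- A chart of the boundary of a cone `Γ`: in a positively oriented orthonormal frame and inside
the open convex cone `{x₀ > 0, |x₁| < δ x₀, |x₂| < η x₀}`, the cone `Γ` is the part
`{x₂ > x₀ u (x₁ / x₀)}` above the cone over the graph of a nearly horizontal function `u`. -/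
structure BoundaryChart (Γ : Set E3) where
  /-- the frame -/
  b : OrthonormalBasis (Fin 3) ℝ E3
  pos : tripleProduct (b 0) (b 1) (b 2) = 1
  /-- the width of the domain of `u` -/
  δ : ℝ
  δ_pos : 0 < δ
  δ_le : δ ≤ 1 / 100
  /-- the height of the chart -/
  η : ℝ
  η_pos : 0 < η
  η_le : η ≤ 1 / 100
  /-- the function whose graph is the boundary in the plane `x₀ = 1` -/
  u : ℝ → ℝ
  contDiffAt : ∀ t ∈ Ioo (-δ) δ, ContDiffAt ℝ 2 u t
  abs_u_lt : ∀ t ∈ Ioo (-δ) δ, |u t| < η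
  abs_deriv_le : ∀ t ∈ Ioo (-δ) δ, |deriv u t| ≤ 1 / 100
  /-- a bound for the second derivative of `u` -/
  M : ℝ
  abs_deriv_deriv_le : ∀ t ∈ Ioo (-δ) δ, |deriv (deriv u) t| ≤ M
  mem_iff : ∀ x : E3, 0 < ⟪b 0, x⟫ → |⟪b 1, x⟫| < δ * ⟪b 0, x⟫ → |⟪b 2, x⟫| < η * ⟪b 0, x⟫ →
    (x ∈ Γ ↔ ⟪b 0, x⟫ * u (⟪b 1, x⟫ / ⟪b 0, x⟫) < ⟪b 2, x⟫)

lemma IsLocalDefiningFunction.eventually_eq_zero {Γ : Set E3} {p : E3} {ρ : E3 → ℝ}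
    (h : IsLocalDefiningFunction Γ p ρ) : ∀ᶠ x in 𝓝 p, x ∈ frontier Γ → ρ x = 0 := by
  filter_upwards [h.mem_iff.eventually_nhds, h.smooth] with x hx hs hxf
  rcases lt_trichotomy (ρ x) 0 with h0 | h0 | h0
  · exfalso
    have h1 : ∀ᶠ y in 𝓝 x, ρ y < 0 := hs.continuousAt.eventually (gt_mem_nhds h0)
    have h2 := mem_closure_iff_frequently.1 (frontier_subset_closure hxf)
    obtain ⟨y, hy, h3, h4⟩ := (h2.and_eventually (h1.and hx)).exists
    exact absurd (h4.1 hy) (by linarith)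
  · exact h0
  · exfalso
    have h1 : ∀ᶠ y in 𝓝 x, 0 < ρ y := hs.continuousAt.eventually (lt_mem_nhds h0)
    refine hxf.2 (mem_interior_iff_mem_nhds.2 ?_)
    filter_upwards [h1, hx] with y h3 h4 using h4.2 h3

lemma IsCone.smul_mem_iff {S : Set E3} (hS : IsCone S) {t : ℝ} (ht : 0 < t) {x : E3} :
    t • x ∈ S ↔ x ∈ S := by
  refine ⟨fun h => ?_, fun h => hS x h t ht⟩
  have := hS _ h t⁻¹ (inv_pos.2 ht)
  rwa [smul_smul, inv_mul_cancel₀ ht.ne', one_smul] at this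

lemma IsCone.compl {S : Set E3} (hS : IsCone S) : IsCone Sᶜ :=
  fun _ hx _ ht h => hx ((hS.smul_mem_iff ht).1 h)

lemma IsCone.closure {S : Set E3} (hS : IsCone S) : IsCone (closure S) := fun _ hx t ht =>
  map_mem_closure (continuous_const_smul t) hx fun y hy => hS y hy t ht

lemma IsCone.interior {S : Set E3} (hS : IsCone S) : IsCone (interior S) := by
  have := hS.compl.closure.compl
  rwa [closure_compl, compl_compl] at this

lemma IsCone.frontier {S : Set E3} (hS : IsCone S) : IsCone (frontier S) := fun x hx t ht =>
  ⟨hS.closure x hx.1 t ht, fun h => hx.2 ((hS.interior.smul_mem_iff ht).1 h)⟩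

lemma ContDiffAt.deriv_of_le {f : ℝ → ℝ} {t : ℝ} {m n : ℕ∞ω} (hf : ContDiffAt ℝ n f t)
    (h : m + 1 ≤ n) : ContDiffAt ℝ m (deriv f) t := by
  have h1 : ContDiffAt ℝ m (fderiv ℝ f) t := hf.fderiv_right h
  have h2 : deriv f = fun s => fderiv ℝ f s 1 := by ext s; simp
  rw [h2]
  exact h1.clm_apply contDiffAt_const

/-- The implicit function theorem, with the sign of the function on both sides of its zero set. -/
lemma exists_implicit_graph {g : ℝ × ℝ → ℝ} (hg : ContDiffAt ℝ ∞ g (0, 0)) (hg0 : g (0, 0) = 0)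
    (h1 : fderiv ℝ g (0, 0) (1, 0) = 0) (h2 : 0 < fderiv ℝ g (0, 0) (0, 1))
    {P : ℝ × ℝ → Prop} (hP : ∀ᶠ v in 𝓝 (0, 0), P v) :
    ∃ (u : ℝ → ℝ) (δ η M : ℝ), 0 < δ ∧ δ ≤ 1 / 100 ∧ 0 < η ∧ η ≤ 1 / 100 ∧
      (∀ t ∈ Ioo (-δ) δ, ContDiffAt ℝ 2 u t ∧ |u t| < η ∧ |deriv u t| ≤ 1 / 100 ∧
        |deriv (deriv u) t| ≤ M) ∧
      ∀ t ∈ Ioo (-δ) δ, ∀ z ∈ Ioo (-η) η, P (t, z) ∧ (0 < g (t, z) ↔ u t < z) := by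
  have hinv : (fderiv ℝ g (0, 0) ∘L .inr ℝ ℝ ℝ).IsInvertible := by
    refine ⟨ContinuousLinearEquiv.unitsEquivAut ℝ (Units.mk0 _ h2.ne'), ?_⟩
    ext; simp
  set u := hg.implicitFunction (by simp) hinv with hu
  have hu0 : u 0 = 0 := hg.implicitFunction_apply_self (by simp) hinv
  have hud : ContDiffAt ℝ ∞ u 0 := hg.contDiffAt_implicitFunction (by simp) hinv
  have hug : ∀ᶠ t in 𝓝 (0 : ℝ), g (t, u t) = 0 := by
    have := hg.eventually_apply_implicitFunction (by simp) hinv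
    rwa [hg0] at this
  have hdu0 : deriv u 0 = 0 := by
    have a1 : HasDerivAt u (deriv u 0) 0 := (hud.differentiableAt (by simp)).hasDerivAt
    have a2 : HasDerivAt (fun t => (t, u t)) ((1 : ℝ), deriv u 0) 0 := (hasDerivAt_id' 0).prodMk a1
    have a3 : HasFDerivAt g (fderiv ℝ g (0, 0)) ((fun t => (t, u t)) 0) := by
      simpa [hu0] using (hg.differentiableAt (by simp)).hasFDerivAt
    have a4 := a3.comp_hasDerivAt 0 a2
    have a5 : HasDerivAt (g ∘ fun t => (t, u t)) 0 0 :=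
      (hasDerivAt_const 0 (0 : ℝ)).congr_of_eventuallyEq hug
    have a6 := a4.unique a5
    have a7 : ((1 : ℝ), deriv u 0) = (1, 0) + deriv u 0 • ((0 : ℝ), (1 : ℝ)) := by simp
    rw [a7, map_add, map_smul, h1, zero_add, smul_eq_mul] at a6
    exact (mul_eq_zero.1 a6).resolve_right h2.ne'
  have hd1 : ContDiffAt ℝ ∞ (deriv u) 0 := hud.deriv_of_le (by simp)
  have hd2 : ContDiffAt ℝ ∞ (deriv (deriv u)) 0 := hd1.deriv_of_le (by simp)
  have ev1 : ∀ᶠ t in 𝓝 (0 : ℝ), ContDiffAt ℝ 2 u t :=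
    (ContDiffAt.of_le hud (WithTop.coe_le_coe.2 (le_top : (2 : ℕ∞) ≤ ⊤))).eventually (by simp)
  have ev2 : ∀ᶠ t in 𝓝 (0 : ℝ), |deriv u t| < 1 / 100 := by
    refine hd1.continuousAt.abs.eventually (gt_mem_nhds ?_)
    simp [hdu0]
  have ev3 : ∀ᶠ t in 𝓝 (0 : ℝ), |deriv (deriv u) t| < |deriv (deriv u) 0| + 1 :=
    hd2.continuousAt.abs.eventually (gt_mem_nhds (lt_add_one _))
  have hgd : ∀ᶠ v in 𝓝 ((0 : ℝ), (0 : ℝ)), ContDiffAt ℝ 1 g v :=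
    (hg.of_le (by exact_mod_cast le_top)).eventually (by simp)
  have hgp : ∀ᶠ v in 𝓝 ((0 : ℝ), (0 : ℝ)), 0 < fderiv ℝ g v (0, 1) := by
    have : ContDiffAt ℝ 0 (fderiv ℝ g) (0, 0) := hg.fderiv_right (by simp)
    exact (this.continuousAt.clm_apply continuousAt_const).eventually (lt_mem_nhds h2)
  obtain ⟨ε, hε, hε'⟩ := Metric.eventually_nhds_iff_ball.1 (hP.and (hgd.and hgp))
  set η := min ε (1 / 100) with hη
  have hηpos : 0 < η := lt_min hε (by norm_num)
  have ev4 : ∀ᶠ t in 𝓝 (0 : ℝ), |u t| < η := by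
    refine hud.continuousAt.abs.eventually (gt_mem_nhds ?_)
    simpa [hu0] using hηpos
  obtain ⟨ε', hε'0, hε'1⟩ := Metric.eventually_nhds_iff_ball.1
    (hug.and (ev1.and (ev2.and (ev3.and ev4))))
  set δ := min ε' η with hδ
  have hδpos : 0 < δ := lt_min hε'0 hηpos
  have key : ∀ t ∈ Ioo (-δ) δ, t ∈ ball (0 : ℝ) ε' := fun t ht => by
    rw [mem_ball_zero_iff, Real.norm_eq_abs]
    exact (abs_lt.2 ht).trans_le (min_le_left _ _)
  refine ⟨u, δ, η, |deriv (deriv u) 0| + 1, hδpos, (min_le_right _ _).trans (min_le_right _ _),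
    hηpos, min_le_right _ _, fun t ht => ?_, fun t ht z hz => ?_⟩
  · obtain ⟨-, b1, b2, b3, b4⟩ := hε'1 t (key t ht)
    exact ⟨b1, b4, b2.le, b3.le⟩
  · obtain ⟨b0, -, -, -, b4⟩ := hε'1 t (key t ht)
    have hball : ∀ w ∈ Ioo (-η) η, ((t, w) : ℝ × ℝ) ∈ ball ((0 : ℝ), (0 : ℝ)) ε := by
      intro w hw
      rw [mem_ball, Prod.dist_eq, max_lt_iff]
      simp only [dist_zero_right, Real.norm_eq_abs]
      exact ⟨(abs_lt.2 ht).trans_le ((min_le_right _ _).trans (min_le_left _ _)),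
        (abs_lt.2 hw).trans_le (min_le_left _ _)⟩
    refine ⟨(hε' _ (hball z hz)).1, ?_⟩
    have hder : ∀ w ∈ Ioo (-η) η, HasDerivAt (fun w => g (t, w)) (fderiv ℝ g (t, w) (0, 1)) w := by
      intro w hw
      have c1 := ((hε' _ (hball w hw)).2.1.differentiableAt (by simp)).hasFDerivAt
      exact c1.comp_hasDerivAt w ((hasDerivAt_const w t).prodMk (hasDerivAt_id' w))
    have hmono : StrictMonoOn (fun w => g (t, w)) (Ioo (-η) η) := by
      refine strictMonoOn_of_deriv_pos (convex_Ioo _ _)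
        (fun w hw => (hder w hw).continuousAt.continuousWithinAt) fun w hw => ?_
      rw [interior_Ioo] at hw
      rw [(hder w hw).deriv]
      exact (hε' _ (hball w hw)).2.2
    rw [← hmono.lt_iff_lt (abs_lt.1 b4) hz]
    simp only [b0]

/-- Every point of the boundary at distance one from the origin lies on the axis of a chart. -/
lemma exists_boundaryChart {Γ : Set E3} (hcone : IsCone Γ) (hsmooth : HasSmoothBoundaryOffOrigin Γ)
    {p : E3} (hp : p ∈ frontier Γ) (hp1 : ‖p‖ = 1) :
    ∃ C : BoundaryChart Γ, C.b 0 = p := by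
  have hp0 : p ≠ 0 := by rintro rfl; simp at hp1
  obtain ⟨ρ, hρ⟩ := hsmooth p hp hp0
  have hρp := hρ.smooth.self_of_nhds
  have hd : HasFDerivAt ρ (fderiv ℝ ρ p) p := (hρp.differentiableAt (by simp)).hasFDerivAt
  have hn0 : 0 < ‖∇ ρ p‖ := norm_pos_iff.2 hρ.gradient_ne_zero
  -- `ρ` vanishes along the ray through `p`
  have hpp : fderiv ℝ ρ p p = 0 := by
    have a1 : HasDerivAt (fun s : ℝ => s • p) p 1 := by
      simpa using (hasDerivAt_id' (1 : ℝ)).smul_const p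
    have a2 : HasFDerivAt ρ (fderiv ℝ ρ p) ((fun s : ℝ => s • p) 1) := by simpa using hd
    have a3 := a2.comp_hasDerivAt 1 a1
    have a4 : ∀ᶠ s in 𝓝 (1 : ℝ), (ρ ∘ fun s : ℝ => s • p) s = 0 := by
      have b1 : Tendsto (fun s : ℝ => s • p) (𝓝 1) (𝓝 p) := by
        simpa using a1.continuousAt.tendsto
      filter_upwards [b1.eventually hρ.eventually_eq_zero, lt_mem_nhds one_pos] with s h1 h2
      exact h1 (hcone.frontier p hp s h2)
    exact a3.unique ((hasDerivAt_const 1 (0 : ℝ)).congr_of_eventuallyEq a4)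
  obtain ⟨b, hb0, hb2, hbpos⟩ := exists_frame (p := p) (n := ‖∇ ρ p‖⁻¹ • ∇ ρ p) hp1
    (by rw [norm_smul, norm_inv, norm_norm, inv_mul_cancel₀ hn0.ne'])
    (by rw [inner_smul_right, real_inner_comm, inner_gradient_left, hpp, mul_zero])
  have hgrad : ∇ ρ p = ‖∇ ρ p‖ • b 2 := by rw [hb2, smul_smul, mul_inv_cancel₀ hn0.ne', one_smul]
  have hfd : ∀ v, fderiv ℝ ρ p v = ‖∇ ρ p‖ * ⟪b 2, v⟫ := fun v => by
    rw [← inner_gradient_left, hgrad, inner_smul_left]; simp [norm_smul]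
  set q : ℝ × ℝ → E3 := fun v => frameVec b 1 v.1 v.2 with hq
  have hqs : ContDiff ℝ ∞ q := by
    simp only [hq, frameVec]; fun_prop
  have hq0 : q (0, 0) = p := by simp [hq, frameVec, hb0]
  have hqd : HasFDerivAt q ((ContinuousLinearMap.fst ℝ ℝ ℝ).smulRight (b 1) +
      (ContinuousLinearMap.snd ℝ ℝ ℝ).smulRight (b 2)) (0, 0) := by
    have h1 : HasFDerivAt (fun v : ℝ × ℝ => v.1 • b 1) ((ContinuousLinearMap.fst ℝ ℝ ℝ).smulRight
      (b 1)) (0, 0) := ((ContinuousLinearMap.fst ℝ ℝ ℝ).smulRight (b 1)).hasFDerivAt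
    have h2 : HasFDerivAt (fun v : ℝ × ℝ => v.2 • b 2) ((ContinuousLinearMap.snd ℝ ℝ ℝ).smulRight
      (b 2)) (0, 0) := ((ContinuousLinearMap.snd ℝ ℝ ℝ).smulRight (b 2)).hasFDerivAt
    convert! (h1.add h2).const_add ((1 : ℝ) • b 0) using 1
    ext1 v
    simp [hq, frameVec, add_assoc]
  have hgd : HasFDerivAt (ρ ∘ q) (fderiv ℝ ρ p ∘L ((ContinuousLinearMap.fst ℝ ℝ ℝ).smulRight (b 1) +
      (ContinuousLinearMap.snd ℝ ℝ ℝ).smulRight (b 2))) (0, 0) := by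
    refine HasFDerivAt.comp _ ?_ hqd
    rw [hq0]; exact hd
  have hP : ∀ᶠ v in 𝓝 ((0 : ℝ), (0 : ℝ)), (q v ∈ Γ ↔ 0 < ρ (q v)) := by
    have : Tendsto q (𝓝 (0, 0)) (𝓝 p) := by
      rw [← hq0]; exact hqs.continuous.continuousAt.tendsto
    exact this.eventually hρ.mem_iff
  obtain ⟨u, δ, η, M, hδ, hδ', hη, hη', hu, hsgn⟩ := exists_implicit_graph (g := ρ ∘ q)
    (ContDiffAt.comp _ (by rw [hq0]; exact hρp) hqs.contDiffAt)
    (by simp [hq0, hρ.eq_zero])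
    (by rw [hgd.fderiv]; simp [hfd])
    (by rw [hgd.fderiv]; simp [hfd, hρ.gradient_ne_zero]) hP
  refine ⟨⟨b, hbpos, δ, hδ, hδ', η, hη, hη', u, fun t ht => (hu t ht).1,
    fun t ht => (hu t ht).2.1, fun t ht => (hu t ht).2.2.1, M, fun t ht => (hu t ht).2.2.2, ?_⟩, hb0⟩
  intro x h0 h1 h2
  obtain ⟨x₀, x₁, x₂, rfl⟩ := exists_frameVec b x
  simp only [inner_frameVec_zero, inner_frameVec_one, inner_frameVec_two] at h0 h1 h2 ⊢
  have e : frameVec b x₀ x₁ x₂ = x₀ • q (x₁ / x₀, x₂ / x₀) := by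
    rw [hq, smul_frameVec, mul_one, mul_div_cancel₀ _ h0.ne', mul_div_cancel₀ _ h0.ne']
  have t1 : x₁ / x₀ ∈ Ioo (-δ) δ := by
    rw [mem_Ioo, ← abs_lt, abs_div, abs_of_pos h0, div_lt_iff₀ h0]; exact h1
  have t2 : x₂ / x₀ ∈ Ioo (-η) η := by
    rw [mem_Ioo, ← abs_lt, abs_div, abs_of_pos h0, div_lt_iff₀ h0]; exact h2
  obtain ⟨s1, s2⟩ := hsgn _ t1 _ t2
  rw [e, hcone.smul_mem_iff h0, s1, ← Function.comp_apply (f := ρ), s2, lt_div_iff₀ h0, mul_comm]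

namespace BoundaryChart

variable {Γ : Set E3} (C : BoundaryChart Γ)

/-- The open convex cone in which the chart describes `Γ`. -/
def box : Set E3 :=
  {x | 0 < ⟪C.b 0, x⟫ ∧ |⟪C.b 1, x⟫| < C.δ * ⟪C.b 0, x⟫ ∧ |⟪C.b 2, x⟫| < C.η * ⟪C.b 0, x⟫}

/-- The boundary curve in the plane `x₀ = 1`. -/
noncomputable def curve (t : ℝ) : E3 := frameVec C.b 1 t (C.u t)

/-- The velocity of the boundary curve. -/
noncomputable def tangent (t : ℝ) : E3 := frameVec C.b 0 1 (deriv C.u t)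

/-- The cross product of the boundary curve with its velocity: a normal vector of `∂Γ` that points
into `Γ`. -/
noncomputable def normal (t : ℝ) : E3 :=
  frameVec C.b (t * deriv C.u t - C.u t) (-deriv C.u t) 1

lemma isOpen_box : IsOpen C.box := by
  have h : ∀ i, Continuous fun x : E3 => ⟪C.b i, x⟫ := fun i => by fun_prop
  exact (isOpen_lt continuous_const (h 0)).inter
    ((isOpen_lt (h 1).abs (continuous_const.mul (h 0))).inter
      (isOpen_lt (h 2).abs (continuous_const.mul (h 0))))

lemma isCone_box : IsCone C.box := by
  rintro x ⟨h0, h1, h2⟩ t ht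
  simp only [box, mem_ofPred_eq, inner_smul_right, abs_mul, abs_of_pos ht]
  refine ⟨by positivity, ?_, ?_⟩ <;> nlinarith

lemma convex_box : Convex ℝ C.box := by
  have key : ∀ (i : Fin 3) (c : ℝ), Convex ℝ {x : E3 | |⟪C.b i, x⟫| < c * ⟪C.b 0, x⟫} := by
    intro i c
    rw [show {x : E3 | |⟪C.b i, x⟫| < c * ⟪C.b 0, x⟫} =
      {x | ⟪C.b i - c • C.b 0, x⟫ < 0} ∩ {x | ⟪-C.b i - c • C.b 0, x⟫ < 0} by
        ext x
        simp only [mem_ofPred_eq, abs_lt, mem_inter_iff, inner_sub_left, inner_smul_left,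
          inner_neg_left, RCLike.conj_to_real]
        constructor <;> rintro ⟨h1, h2⟩ <;> constructor <;> linarith]
    exact (convex_halfSpace_lt (innerₛₗ ℝ (C.b i - c • C.b 0)).isLinear 0).inter
      (convex_halfSpace_lt (innerₛₗ ℝ (-C.b i - c • C.b 0)).isLinear 0)
  exact (convex_halfSpace_gt (innerₛₗ ℝ (C.b 0)).isLinear 0).inter ((key 1 _).inter (key 2 _))

lemma mem_Ioo_of_mem_box {x : E3} (hx : x ∈ C.box) :
    ⟪C.b 1, x⟫ / ⟪C.b 0, x⟫ ∈ Ioo (-C.δ) C.δ := by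
  rw [mem_Ioo, ← abs_lt, abs_div, abs_of_pos hx.1, div_lt_iff₀ hx.1]; exact hx.2.1

lemma smul_curve_mem_box {r t : ℝ} (hr : 0 < r) (ht : t ∈ Ioo (-C.δ) C.δ) :
    r • C.curve t ∈ C.box := by
  refine C.isCone_box _ ?_ r hr
  simp only [box, curve, mem_ofPred_eq, inner_frameVec_zero, inner_frameVec_one, inner_frameVec_two,
    mul_one]
  exact ⟨one_pos, abs_lt.2 ht, C.abs_u_lt t ht⟩

lemma differentiableAt_u {t : ℝ} (ht : t ∈ Ioo (-C.δ) C.δ) : DifferentiableAt ℝ C.u t :=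
  (C.contDiffAt t ht).differentiableAt (by simp)

lemma hasDerivAt_u {t : ℝ} (ht : t ∈ Ioo (-C.δ) C.δ) : HasDerivAt C.u (deriv C.u t) t :=
  (C.differentiableAt_u ht).hasDerivAt

lemma hasDerivAt_deriv_u {t : ℝ} (ht : t ∈ Ioo (-C.δ) C.δ) :
    HasDerivAt (deriv C.u) (deriv (deriv C.u) t) t :=
  (((C.contDiffAt t ht).deriv_of_le (m := 1) (by norm_num)).differentiableAt (by simp)).hasDerivAt

lemma hasDerivAt_curve {t : ℝ} (ht : t ∈ Ioo (-C.δ) C.δ) : HasDerivAt C.curve (C.tangent t) t := by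
  have h := (((hasDerivAt_const t (1 : ℝ)).smul_const (C.b 0)).add
    ((hasDerivAt_id' t).smul_const (C.b 1))).add ((C.hasDerivAt_u ht).smul_const (C.b 2))
  exact h

lemma hasDerivAt_normal {t : ℝ} (ht : t ∈ Ioo (-C.δ) C.δ) :
    HasDerivAt C.normal (deriv (deriv C.u) t • frameVec C.b t (-1) 0) t := by
  have h1 := C.hasDerivAt_u ht
  have h2 := C.hasDerivAt_deriv_u ht
  have h := (((((hasDerivAt_id' t).mul h2).sub h1).smul_const (C.b 0)).add
    (h2.neg.smul_const (C.b 1))).add ((hasDerivAt_const t (1 : ℝ)).smul_const (C.b 2))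
  convert! h using 1
  rw [smul_frameVec, frameVec]
  congr 2 <;> ring_nf

lemma norm_normal_sq (t : ℝ) :
    ‖C.normal t‖ ^ 2 = (t * deriv C.u t - C.u t) ^ 2 + deriv C.u t ^ 2 + 1 := by
  rw [normal, norm_sq_frameVec]; ring

lemma norm_curve_sq (t : ℝ) : ‖C.curve t‖ ^ 2 = 1 + t ^ 2 + C.u t ^ 2 := by
  rw [curve, norm_sq_frameVec]; ring

lemma norm_normal_pos (t : ℝ) : 0 < ‖C.normal t‖ := by
  have := C.norm_normal_sq t
  by_contra h
  have h0 : ‖C.normal t‖ = 0 := le_antisymm (not_lt.1 h) (norm_nonneg _)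
  rw [h0] at this
  nlinarith [sq_nonneg (t * deriv C.u t - C.u t), sq_nonneg (deriv C.u t)]

/-- The boundary of `Γ` is the cone over the graph of `u`. -/
lemma mem_frontier_iff {x : E3} (hx : x ∈ C.box) :
    x ∈ frontier Γ ↔ ⟪C.b 2, x⟫ = ⟪C.b 0, x⟫ * C.u (⟪C.b 1, x⟫ / ⟪C.b 0, x⟫) := by
  set h : E3 → ℝ := fun x => ⟪C.b 2, x⟫ - ⟪C.b 0, x⟫ * C.u (⟪C.b 1, x⟫ / ⟪C.b 0, x⟫) with hh
  have hc : ContinuousAt h x := by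
    have h1 : ContinuousAt C.u (⟪C.b 1, x⟫ / ⟪C.b 0, x⟫) :=
      (C.differentiableAt_u (C.mem_Ioo_of_mem_box hx)).continuousAt
    have h2 : ContinuousAt (fun x : E3 => ⟪C.b 1, x⟫ / ⟪C.b 0, x⟫) x :=
      ContinuousAt.div (by fun_prop) (by fun_prop) hx.1.ne'
    have h3 := ContinuousAt.comp (f := fun x : E3 => ⟪C.b 1, x⟫ / ⟪C.b 0, x⟫) h1 h2
    have h4 : ContinuousAt (fun x : E3 => ⟪C.b 2, x⟫) x := by fun_prop
    have h5 : ContinuousAt (fun x : E3 => ⟪C.b 0, x⟫) x := by fun_prop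
    exact h4.sub (h5.mul h3)
  have hbox : ∀ᶠ y in 𝓝 x, y ∈ C.box := C.isOpen_box.mem_nhds hx
  have hmem : ∀ y ∈ C.box, y ∈ Γ ↔ 0 < h y := fun y hy => by
    rw [C.mem_iff y hy.1 hy.2.1 hy.2.2, hh, sub_pos]
  rw [← sub_eq_zero]
  change x ∈ frontier Γ ↔ h x = 0
  constructor
  · intro hxf
    rcases lt_trichotomy (h x) 0 with h0 | h0 | h0
    · exfalso
      obtain ⟨y, hy, h3, h4⟩ := ((mem_closure_iff_frequently.1
        (frontier_subset_closure hxf)).and_eventually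
          ((hc.eventually (gt_mem_nhds h0)).and hbox)).exists
      exact absurd ((hmem y h4).1 hy) (not_lt.2 h3.le)
    · exact h0
    · exfalso
      refine hxf.2 (mem_interior_iff_mem_nhds.2 ?_)
      filter_upwards [hc.eventually (lt_mem_nhds h0), hbox] with y h3 h4 using (hmem y h4).2 h3
  · intro h0
    refine ⟨?_, fun hi => ?_⟩
    · have h1 : Tendsto (fun s : ℝ => x + s • C.b 2) (𝓝[>] 0) (𝓝 x) := by
        have : ContinuousAt (fun s : ℝ => x + s • C.b 2) 0 := by fun_prop
        have h2 := this.tendsto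
        simp only [zero_smul, add_zero] at h2
        exact h2.mono_left nhdsWithin_le_nhds
      refine mem_closure_of_tendsto h1 ?_
      filter_upwards [h1.eventually hbox, self_mem_nhdsWithin] with s hs hs0
      rw [hmem _ hs]
      have : h (x + s • C.b 2) = h x + s := by
        simp [hh, inner_add_right, inner_smul_right]; ring
      rw [this, h0, zero_add]; exact hs0
    · exact absurd ((hmem x hx).1 (interior_subset hi)) (by rw [h0]; exact lt_irrefl _)

lemma smul_curve_mem_frontier {r t : ℝ} (hr : 0 < r) (ht : t ∈ Ioo (-C.δ) C.δ) :
    r • C.curve t ∈ frontier Γ := by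
  rw [C.mem_frontier_iff (C.smul_curve_mem_box hr ht), curve, smul_frameVec]
  simp [hr.ne']

lemma eq_smul_curve {x : E3} (hx : x ∈ C.box) (hxf : x ∈ frontier Γ) :
    x = ⟪C.b 0, x⟫ • C.curve (⟪C.b 1, x⟫ / ⟪C.b 0, x⟫) := by
  have h := (C.mem_frontier_iff hx).1 hxf
  rw [curve, smul_frameVec, mul_one, mul_div_cancel₀ _ hx.1.ne', ← h, frameVec_inner]

lemma mem_compl_box_iff {x : E3} (hx : x ∈ C.box) :
    x ∈ Γᶜ ↔ ⟪C.b 2, x⟫ ≤ ⟪C.b 0, x⟫ * C.u (⟪C.b 1, x⟫ / ⟪C.b 0, x⟫) := by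
  rw [mem_compl_iff, C.mem_iff x hx.1 hx.2.1 hx.2.2, not_lt]

/-- At points of the chart, every local defining function has gradient in the direction of the
normal. -/
lemma gradient_eq {ρ : E3 → ℝ} {r t : ℝ} (hr : 0 < r) (ht : t ∈ Ioo (-C.δ) C.δ)
    (hd : DifferentiableAt ℝ ρ (r • C.curve t)) (h0 : ∇ ρ (r • C.curve t) ≠ 0)
    (hz : ∀ᶠ x in 𝓝 (r • C.curve t), x ∈ frontier Γ → ρ x = 0)
    (hm : ∀ᶠ x in 𝓝 (r • C.curve t), (x ∈ Γ ↔ 0 < ρ x)) :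
    ‖∇ ρ (r • C.curve t)‖⁻¹ • ∇ ρ (r • C.curve t) = ‖C.normal t‖⁻¹ • C.normal t := by
  set q := r • C.curve t with hq
  have hqf : q ∈ frontier Γ := C.smul_curve_mem_frontier hr ht
  have hρq : ρ q = 0 := hz.self_of_nhds hqf
  have hf : HasFDerivAt ρ (fderiv ℝ ρ q) q := hd.hasFDerivAt
  -- the derivative of `ρ` along the generator
  have e1 : ⟪∇ ρ q, C.curve t⟫ = 0 := by
    rw [inner_gradient_left]
    have a1 : HasDerivAt (fun s : ℝ => s • C.curve t) (C.curve t) r := by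
      simpa using (hasDerivAt_id' r).smul_const (C.curve t)
    have a3 := HasFDerivAt.comp_hasDerivAt (f := fun s : ℝ => s • C.curve t) r hf a1
    refine a3.unique ((hasDerivAt_const r (0 : ℝ)).congr_of_eventuallyEq ?_)
    filter_upwards [a1.continuousAt.tendsto.eventually hz, lt_mem_nhds hr] with s h1 h2
    exact h1 (C.smul_curve_mem_frontier h2 ht)
  -- the derivative of `ρ` along the boundary curve
  have e2 : ⟪∇ ρ q, C.tangent t⟫ = 0 := by
    have a1 : HasDerivAt (fun s : ℝ => r • C.curve s) (r • C.tangent t) t :=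
      (C.hasDerivAt_curve ht).const_smul r
    have a3 := HasFDerivAt.comp_hasDerivAt (f := fun s : ℝ => r • C.curve s) t hf a1
    have a4 : fderiv ℝ ρ q (r • C.tangent t) = 0 := by
      refine a3.unique ((hasDerivAt_const t (0 : ℝ)).congr_of_eventuallyEq ?_)
      filter_upwards [a1.continuousAt.tendsto.eventually hz, isOpen_Ioo.mem_nhds ht] with s h1 h2
      exact h1 (C.smul_curve_mem_frontier hr h2)
    rw [map_smul, smul_eq_mul] at a4
    rw [inner_gradient_left]
    exact (mul_eq_zero.1 a4).resolve_left hr.ne'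
  -- `ρ` does not decrease in the direction of the last axis
  have e3 : 0 ≤ ⟪∇ ρ q, C.b 2⟫ := by
    rw [inner_gradient_left]
    have a1 : HasDerivAt (fun s : ℝ => q + s • C.b 2) (C.b 2) 0 := by
      simpa using ((hasDerivAt_id' (0 : ℝ)).smul_const (C.b 2)).const_add q
    have a2 : HasFDerivAt ρ (fderiv ℝ ρ q) ((fun s : ℝ => q + s • C.b 2) 0) := by simpa using hf
    have a3 := (a2.comp_hasDerivAt 0 a1).tendsto_slope_zero_right
    refine ge_of_tendsto a3 ?_
    have a4 : Tendsto (fun s : ℝ => q + s • C.b 2) (𝓝[>] 0) (𝓝 q) := by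
      have := a1.continuousAt.tendsto
      simp only [zero_smul, add_zero] at this
      exact this.mono_left nhdsWithin_le_nhds
    filter_upwards [a4.eventually hm, a4.eventually (C.isOpen_box.mem_nhds
      (C.smul_curve_mem_box hr ht)), self_mem_nhdsWithin] with s h1 h2 h3
    have h3 : 0 < s := h3
    have h4 : q + s • C.b 2 ∈ Γ := by
      rw [C.mem_iff _ h2.1 h2.2.1 h2.2.2]
      have := (C.mem_frontier_iff (C.smul_curve_mem_box hr ht)).1 hqf
      simp only [inner_add_right, inner_smul_right, inner_frame, ← hq] at this ⊢
      simp
      linarith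
    have h5 := h1.1 h4
    simp only [zero_add, Function.comp_apply, zero_smul, add_zero, hρq, sub_zero, smul_eq_mul]
    positivity
  obtain ⟨g₀, g₁, g₂, hg⟩ := exists_frameVec C.b (∇ ρ q)
  rw [hg, curve, frameVec_inner_frameVec] at e1
  rw [hg, tangent, frameVec_inner_frameVec] at e2
  rw [hg, real_inner_comm, inner_frameVec_two] at e3
  have e4 : ∇ ρ q = g₂ • C.normal t := by
    rw [hg, normal, smul_frameVec]
    congr 1
    · linear_combination e1 - t * e2
    · linear_combination e2
    · ring
  have e5 : 0 < g₂ := by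
    rcases e3.lt_or_eq with h | h
    · exact h
    · rw [← h, zero_smul] at e4; exact absurd e4 h0
  have hN := C.norm_normal_pos t
  rw [e4, norm_smul, Real.norm_of_nonneg e5.le, smul_smul]
  congr 1
  field_simp

end BoundaryChart

/-! ### Mean curvature in a chart -/

/-- The trace of an endomorphism `L` of three-space that kills the vector `(1, t, u)`, maps
`(0, 1, u')` to `v`, and takes values orthogonal to the cross product of these two vectors. -/
lemma sum_inner_eq_of_kernel (b : OrthonormalBasis (Fin 3) ℝ E3) (L : E3 →L[ℝ] E3) {t u u' : ℝ}
    (h1 : L (frameVec b 1 t u) = 0)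
    (h2 : ∀ w, ⟪frameVec b (t * u' - u) (-u') 1, L w⟫ = 0) :
    (∑ i, ⟪b i, L (b i)⟫) * ((t * u' - u) ^ 2 + u' ^ 2 + 1) =
      ⟪frameVec b (-u' * u - t) (1 - (t * u' - u) * u) ((t * u' - u) * t + u'),
        L (frameVec b 0 1 u')⟫ := by
  have k0 := congrArg (fun v => ⟪b 0, v⟫) h1
  have k1 := congrArg (fun v => ⟪b 1, v⟫) h1
  have k2 := congrArg (fun v => ⟪b 2, v⟫) h1
  have n0 := h2 (b 0)
  have n1 := h2 (b 1)
  have n2 := h2 (b 2)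
  simp only [frameVec, map_add, map_smul, inner_add_right, inner_smul_right, inner_zero_right,
    inner_add_left, inner_smul_left, RCLike.conj_to_real, Fin.sum_univ_three] at *
  generalize ⟪b 0, L (b 0)⟫ = m00 at *
  generalize ⟪b 1, L (b 1)⟫ = m11 at *
  generalize ⟪b 2, L (b 2)⟫ = m22 at *
  generalize ⟪b 2, L (b 1)⟫ = m21 at *
  have e00 : m00 = -(t * ⟪b 0, L (b 1)⟫ + u * ⟪b 0, L (b 2)⟫) := by linarith
  have e21 : m21 = -((t * u' - u) * ⟪b 0, L (b 1)⟫) + u' * m11 := by linarith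
  have e22 : m22 = -((t * u' - u) * ⟪b 0, L (b 2)⟫) + u' * ⟪b 1, L (b 2)⟫ := by linarith
  rw [e00, e21, e22]
  ring

lemma euclideanDiv_eq_sum_inner (b : OrthonormalBasis (Fin 3) ℝ E3) (X : E3 → E3) (p : E3) :
    euclideanDiv X p = ∑ i, ⟪b i, fderiv ℝ X p (b i)⟫ := by
  have h1 := LinearMap.trace_eq_sum_inner (fderiv ℝ X p : E3 →ₗ[ℝ] E3) b
  have h2 := LinearMap.trace_eq_sum_inner (fderiv ℝ X p : E3 →ₗ[ℝ] E3)
    (EuclideanSpace.basisFun (Fin 3) ℝ)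
  rw [euclideanDiv]
  simp only [ContinuousLinearMap.coe_coe] at h1 h2
  rw [← h1, h2]
  simp [EuclideanSpace.inner_single_left]

namespace BoundaryChart

variable {Γ : Set E3} (C : BoundaryChart Γ)

/-- The divergence at the point `r γ(t)` of the unit normal of a chart with boundary curve `γ` and
normal `N` is `-u'' |γ|² / (r |N|³)`, whichever local defining function is used. -/
lemma euclideanDiv_eq {r t : ℝ} (hr : 0 < r) (ht : t ∈ Ioo (-C.δ) C.δ) {ρ : E3 → ℝ}
    (hρ : IsLocalDefiningFunction Γ (r • C.curve t) ρ) :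
    euclideanDiv (fun x => ‖∇ ρ x‖⁻¹ • ∇ ρ x) (r • C.curve t) =
      -deriv (deriv C.u) t * ‖C.curve t‖ ^ 2 / (r * ‖C.normal t‖ ^ 3) := by
  set q := r • C.curve t with hq
  set X : E3 → E3 := fun x => ‖∇ ρ x‖⁻¹ • ∇ ρ x with hX
  have hgc : ContDiffAt ℝ 1 (∇ ρ) q := by
    have h0 : ContDiffAt ℝ ∞ (fderiv ℝ ρ) q := hρ.smooth.self_of_nhds.fderiv_right (by simp)
    have h1 : ContDiffAt ℝ 1 (fderiv ℝ ρ) q := h0.of_le (by exact_mod_cast le_top)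
    exact (InnerProductSpace.toDual ℝ E3).symm.contDiff.contDiffAt.comp q h1
  have hg0 : ∀ᶠ x in 𝓝 q, ∇ ρ x ≠ 0 := hgc.continuousAt.eventually_ne hρ.gradient_ne_zero
  have hXd : HasFDerivAt X (fderiv ℝ X q) q := by
    have h1 : ContDiffAt ℝ 1 X q :=
      ((hgc.norm ℝ hρ.gradient_ne_zero).inv (norm_ne_zero_iff.2 hρ.gradient_ne_zero)).smul hgc
    exact (h1.differentiableAt (by simp)).hasFDerivAt
  -- the unit normal field along the surface is the normalized `C.normal`
  have hXN : ∀ᶠ x in 𝓝 q, ∀ r' : ℝ, 0 < r' → ∀ t' ∈ Ioo (-C.δ) C.δ, x = r' • C.curve t' →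
      X x = ‖C.normal t'‖⁻¹ • C.normal t' := by
    filter_upwards [hρ.smooth, hg0, hρ.eventually_eq_zero.eventually_nhds,
      hρ.mem_iff.eventually_nhds] with x h1 h2 h3 h4 r' hr' t' ht' hx
    rw [hx] at h1 h2 h3 h4 ⊢
    exact C.gradient_eq hr' ht' (h1.differentiableAt (by simp)) h2 h3 h4
  have hN := C.norm_normal_pos t
  -- the unit normal is constant along the generator
  have d1 : fderiv ℝ X q (C.curve t) = 0 := by
    have a1 : HasDerivAt (fun s : ℝ => s • C.curve t) (C.curve t) r := by
      simpa using (hasDerivAt_id' r).smul_const (C.curve t)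
    have a3 := HasFDerivAt.comp_hasDerivAt (f := fun s : ℝ => s • C.curve t) r hXd a1
    refine a3.unique ((hasDerivAt_const r (‖C.normal t‖⁻¹ • C.normal t)).congr_of_eventuallyEq ?_)
    filter_upwards [a1.continuousAt.tendsto.eventually hXN, lt_mem_nhds hr] with s h1 h2
    exact h1 s h2 t ht rfl
  -- the derivative of the unit normal along the boundary curve
  have d2 : deriv (deriv C.u) t • frameVec C.b t (-1) 0 =
      ‖C.normal t‖ • r • fderiv ℝ X q (C.tangent t) +
        deriv (fun s => ‖C.normal s‖) t • (‖C.normal t‖⁻¹ • C.normal t) := by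
    have a1 : HasDerivAt (fun s : ℝ => r • C.curve s) (r • C.tangent t) t :=
      (C.hasDerivAt_curve ht).const_smul r
    have a3 := HasFDerivAt.comp_hasDerivAt (f := fun s : ℝ => r • C.curve s) t hXd a1
    have a4 : HasDerivAt (fun s => ‖C.normal s‖) (deriv (fun s => ‖C.normal s‖) t) t :=
      ((C.hasDerivAt_normal ht).differentiableAt.norm ℝ
        (norm_pos_iff.1 hN)).hasDerivAt
    have a5 := a4.smul a3
    rw [map_smul] at a5
    have a6 : (X ∘ fun s : ℝ => r • C.curve s) t = ‖C.normal t‖⁻¹ • C.normal t :=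
      hXN.self_of_nhds r hr t ht rfl
    rw [a6] at a5
    refine (C.hasDerivAt_normal ht).unique (a5.congr_of_eventuallyEq ?_)
    filter_upwards [a1.continuousAt.tendsto.eventually hXN, isOpen_Ioo.mem_nhds ht] with s h1 h2
    rw [Pi.smul_apply', Function.comp_apply, h1 r hr s h2 rfl, smul_smul,
      mul_inv_cancel₀ (C.norm_normal_pos s).ne', one_smul]
  -- a unit field has derivative orthogonal to itself
  have d3 : ∀ w, ⟪C.normal t, fderiv ℝ X q w⟫ = 0 := by
    intro w
    have a1 : HasFDerivAt (fun x => ⟪X x, X x⟫) _ q := hXd.inner ℝ hXd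
    have a2 : HasFDerivAt (fun x => ⟪X x, X x⟫) (0 : E3 →L[ℝ] ℝ) q := by
      refine (hasFDerivAt_const (1 : ℝ) q).congr_of_eventuallyEq ?_
      filter_upwards [hg0] with x hx
      rw [real_inner_self_eq_norm_sq, hX, norm_smul, norm_inv, norm_norm,
        inv_mul_cancel₀ (norm_ne_zero_iff.2 hx), one_pow]
    have a3 := congrArg (fun L => L w) (a1.unique a2)
    have a6 : X q = ‖C.normal t‖⁻¹ • C.normal t := hXN.self_of_nhds r hr t ht rfl
    simp only [ContinuousLinearMap.comp_apply, ContinuousLinearMap.prod_apply,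
      fderivInnerCLM_apply, _root_.zero_apply] at a3
    rw [real_inner_comm, ← two_mul, a6, inner_smul_right, real_inner_comm] at a3
    simpa [hN.ne'] using a3
  have tr := sum_inner_eq_of_kernel C.b (fderiv ℝ X q) (t := t) (u := C.u t) (u' := deriv C.u t)
    d1 d3
  rw [← euclideanDiv_eq_sum_inner, ← C.norm_normal_sq t] at tr
  have d4 := congrArg (fun v => ⟪frameVec C.b (-deriv C.u t * C.u t - t)
    (1 - (t * deriv C.u t - C.u t) * C.u t) ((t * deriv C.u t - C.u t) * t + deriv C.u t), v⟫) d2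
  simp only [inner_add_right, inner_smul_right] at d4
  rw [tangent] at d4
  rw [← tr, frameVec_inner_frameVec, normal, frameVec_inner_frameVec, ← normal] at d4
  rw [C.norm_curve_sq, eq_div_iff (by positivity)]
  linear_combination -d4

lemma meanCurvature_eq (hsmooth : HasSmoothBoundaryOffOrigin Γ) {r t : ℝ} (hr : 0 < r)
    (ht : t ∈ Ioo (-C.δ) C.δ) :
    meanCurvature Γ (r • C.curve t) =
      -deriv (deriv C.u) t * ‖C.curve t‖ ^ 2 / (r * ‖C.normal t‖ ^ 3) := by
  have hq0 : r • C.curve t ≠ 0 := by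
    intro h
    have := (C.smul_curve_mem_box hr ht).1
    rw [h, inner_zero_right] at this
    exact lt_irrefl _ this
  have hex := hsmooth _ (C.smul_curve_mem_frontier hr ht) hq0
  rw [meanCurvature, dif_pos hex]
  exact C.euclideanDiv_eq hr ht hex.choose_spec

end BoundaryChart

/-! ### Convexity of the complement in a chart -/

namespace BoundaryChart

variable {Γ : Set E3} (C : BoundaryChart Γ)

lemma ne_zero_of_mem_box {x : E3} (hx : x ∈ C.box) : x ≠ 0 := by
  rintro rfl
  have := hx.1
  rw [inner_zero_right] at this
  exact lt_irrefl _ this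

lemma norm_curve_pos (t : ℝ) : 0 < ‖C.curve t‖ := by
  have := C.norm_curve_sq t
  by_contra h
  have h0 : ‖C.curve t‖ = 0 := le_antisymm (not_lt.1 h) (norm_nonneg _)
  rw [h0] at this
  nlinarith [sq_nonneg t, sq_nonneg (C.u t)]

lemma deriv_deriv_u_nonpos (hsmooth : HasSmoothBoundaryOffOrigin Γ)
    (hH : ∀ p ∈ frontier Γ, p ≠ 0 → 0 ≤ meanCurvature Γ p) {t : ℝ} (ht : t ∈ Ioo (-C.δ) C.δ) :
    deriv (deriv C.u) t ≤ 0 := by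
  have h := hH _ (C.smul_curve_mem_frontier one_pos ht)
    (C.ne_zero_of_mem_box (C.smul_curve_mem_box one_pos ht))
  rw [C.meanCurvature_eq hsmooth one_pos ht] at h
  by_contra hlt
  have h1 := C.norm_normal_pos t
  have h2 := C.norm_curve_pos t
  have : -deriv (deriv C.u) t * ‖C.curve t‖ ^ 2 / (1 * ‖C.normal t‖ ^ 3) < 0 :=
    div_neg_of_neg_of_pos (mul_neg_of_neg_of_pos (by linarith) (by positivity)) (by positivity)
  linarith

lemma concaveOn_u (hsmooth : HasSmoothBoundaryOffOrigin Γ)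
    (hH : ∀ p ∈ frontier Γ, p ≠ 0 → 0 ≤ meanCurvature Γ p) : ConcaveOn ℝ (Ioo (-C.δ) C.δ) C.u := by
  refine concaveOn_of_deriv2_nonpos (convex_Ioo _ _)
    (fun t ht => (C.differentiableAt_u ht).continuousAt.continuousWithinAt) ?_ ?_ ?_ <;>
    rw [interior_Ioo]
  · exact fun t ht => (C.differentiableAt_u ht).differentiableWithinAt
  · exact fun t ht => (C.hasDerivAt_deriv_u ht).differentiableAt.differentiableWithinAt
  · exact fun t ht => C.deriv_deriv_u_nonpos hsmooth hH ht

/-- If the mean curvature is nonnegative, the complement of `Γ` is convex inside the chart: it is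
the subgraph of the perspective of a concave function. -/
lemma convex_compl_inter_box (hsmooth : HasSmoothBoundaryOffOrigin Γ)
    (hH : ∀ p ∈ frontier Γ, p ≠ 0 → 0 ≤ meanCurvature Γ p) : Convex ℝ (Γᶜ ∩ C.box) := by
  rintro x ⟨hxK, hx⟩ y ⟨hyK, hy⟩ a b ha hb hab
  have hz : a • x + b • y ∈ C.box := C.convex_box hx hy ha hb hab
  refine ⟨?_, hz⟩
  rw [C.mem_compl_box_iff hx] at hxK
  rw [C.mem_compl_box_iff hy] at hyK
  rw [C.mem_compl_box_iff hz]
  have hz0 := hz.1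
  simp only [inner_add_right, inner_smul_right] at hz0 ⊢
  have hx0 := hx.1
  have hy0 := hy.1
  set x₀ := ⟪C.b 0, x⟫
  set y₀ := ⟪C.b 0, y⟫
  have hc := (C.concaveOn_u hsmooth hH).2 (C.mem_Ioo_of_mem_box hx) (C.mem_Ioo_of_mem_box hy)
    (show 0 ≤ a * x₀ / (a * x₀ + b * y₀) by positivity)
    (show 0 ≤ b * y₀ / (a * x₀ + b * y₀) by positivity) (by rw [← add_div, div_self hz0.ne'])
  simp only [smul_eq_mul] at hc
  have e : a * x₀ / (a * x₀ + b * y₀) * (⟪C.b 1, x⟫ / x₀) +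
      b * y₀ / (a * x₀ + b * y₀) * (⟪C.b 1, y⟫ / y₀) =
      (a * ⟪C.b 1, x⟫ + b * ⟪C.b 1, y⟫) / (a * x₀ + b * y₀) := by
    field_simp
  rw [e] at hc
  have h2 := mul_le_mul_of_nonneg_left hc hz0.le
  have e2 : (a * x₀ + b * y₀) * (a * x₀ / (a * x₀ + b * y₀) * C.u (⟪C.b 1, x⟫ / x₀) +
      b * y₀ / (a * x₀ + b * y₀) * C.u (⟪C.b 1, y⟫ / y₀)) =
      a * (x₀ * C.u (⟪C.b 1, x⟫ / x₀)) + b * (y₀ * C.u (⟪C.b 1, y⟫ / y₀)) := by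
    field_simp
  rw [e2] at h2
  have h3 := mul_le_mul_of_nonneg_left hxK ha
  have h4 := mul_le_mul_of_nonneg_left hyK hb
  linarith

end BoundaryChart

/-! ### Components of the interior of the complement -/

/-- Locally, off the origin, a set coincides with a convex set. -/
def IsLocallyConvexOffOrigin (K : Set E3) : Prop :=
  ∀ p ∈ K, p ≠ 0 → ∃ B : Set E3, IsOpen B ∧ p ∈ B ∧ Convex ℝ (K ∩ B)

/-- Every point of the boundary off the origin lies in the box of a chart. -/
lemma exists_boundaryChart_mem_box {Γ : Set E3} (hcone : IsCone Γ)
    (hsmooth : HasSmoothBoundaryOffOrigin Γ) {p : E3} (hp : p ∈ frontier Γ) (hp0 : p ≠ 0) :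
    ∃ C : BoundaryChart Γ, p ∈ C.box := by
  have hn : 0 < ‖p‖ := norm_pos_iff.2 hp0
  obtain ⟨C, hC⟩ := exists_boundaryChart hcone hsmooth
    (p := ‖p‖⁻¹ • p) (hcone.frontier p hp _ (inv_pos.2 hn))
    (by rw [norm_smul, norm_inv, norm_norm, inv_mul_cancel₀ hn.ne'])
  refine ⟨C, ?_⟩
  have : p = ‖p‖ • C.b 0 := by rw [hC, smul_smul, mul_inv_cancel₀ hn.ne', one_smul]
  rw [this]
  refine C.isCone_box _ ?_ _ hn
  simp [BoundaryChart.box, C.δ_pos, C.η_pos]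

lemma isLocallyConvexOffOrigin_compl {Γ : Set E3} (hcone : IsCone Γ)
    (hsmooth : HasSmoothBoundaryOffOrigin Γ)
    (hH : ∀ p ∈ frontier Γ, p ≠ 0 → 0 ≤ meanCurvature Γ p) : IsLocallyConvexOffOrigin Γᶜ := by
  intro p hp hp0
  by_cases hpf : p ∈ frontier Γ
  · obtain ⟨C, hC⟩ := exists_boundaryChart_mem_box hcone hsmooth hpf hp0
    exact ⟨C.box, C.isOpen_box, hC, C.convex_compl_inter_box hsmooth hH⟩
  · have hpi : p ∈ interior Γᶜ := by
      rw [interior_compl]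
      intro hcl
      exact hpf ⟨hcl, fun h => hp (interior_subset h)⟩
    obtain ⟨ε, hε, hb⟩ := Metric.isOpen_iff.1 isOpen_interior p hpi
    refine ⟨ball p ε, isOpen_ball, mem_ball_self hε, ?_⟩
    rw [inter_eq_right.2 (hb.trans interior_subset)]
    exact convex_ball _ _

/-- Off the origin, the complement of `Γ` is contained in the closure of its interior. -/
lemma compl_subset_closure_interior {Γ : Set E3} (hcone : IsCone Γ)
    (hsmooth : HasSmoothBoundaryOffOrigin Γ) {p : E3} (hp : p ∈ Γᶜ) (hp0 : p ≠ 0) :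
    p ∈ closure (interior Γᶜ) := by
  by_cases hpf : p ∈ frontier Γ
  · obtain ⟨C, hC⟩ := exists_boundaryChart_mem_box hcone hsmooth hpf hp0
    have hc : ContinuousAt (fun s : ℝ => p + s • C.b 2) 0 := by fun_prop
    have h1 : Tendsto (fun s : ℝ => p + s • C.b 2) (𝓝[<] 0) (𝓝 p) := by
      have := hc.tendsto
      simp only [zero_smul, add_zero] at this
      exact this.mono_left nhdsWithin_le_nhds
    refine mem_closure_of_tendsto h1 ?_
    filter_upwards [h1.eventually (C.isOpen_box.mem_nhds hC), self_mem_nhdsWithin] with s hs hs0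
    have hs0 : s < 0 := hs0
    have h2 := (C.mem_frontier_iff hC).1 hpf
    have e0 : ⟪C.b 0, p + s • C.b 2⟫ = ⟪C.b 0, p⟫ := by
      simp [inner_add_right, inner_smul_right]
    have e1 : ⟪C.b 1, p + s • C.b 2⟫ = ⟪C.b 1, p⟫ := by
      simp [inner_add_right, inner_smul_right]
    have e2 : ⟪C.b 2, p + s • C.b 2⟫ = ⟪C.b 2, p⟫ + s := by
      simp [inner_add_right, inner_smul_right]
    rw [interior_compl]
    intro hcl
    rw [closure_eq_self_union_frontier] at hcl
    rcases hcl with h | h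
    · rw [C.mem_iff _ hs.1 hs.2.1 hs.2.2, e0, e1, e2] at h
      linarith
    · rw [C.mem_frontier_iff hs, e0, e1, e2] at h
      linarith
  · refine subset_closure ?_
    rw [interior_compl]
    exact fun hcl => hpf ⟨hcl, fun h => hp (interior_subset h)⟩

/-- A segment of a locally convex set that joins two interior points consists of interior points:
at a first boundary point, the segment would leave the interior of a convex set at an interior point
of the segment. -/
lemma IsLocallyConvexOffOrigin.segment_subset_interior {K : Set E3}
    (hK : IsLocallyConvexOffOrigin K) {x y : E3} (hx : x ∈ interior K) (hy : y ∈ interior K)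
    (hxy : segment ℝ x y ⊆ K) (h0 : (0 : E3) ∉ segment ℝ x y) : segment ℝ x y ⊆ interior K := by
  set f : ℝ → E3 := fun s => AffineMap.lineMap x y s with hf
  have hfc : Continuous f := AffineMap.lineMap_continuous
  have hseg : segment ℝ x y = f '' Icc 0 1 := segment_eq_image_lineMap ℝ x y
  by_contra hcon
  set B : Set ℝ := Icc 0 1 ∩ f ⁻¹' (interior K)ᶜ with hB
  have hBc : IsCompact B :=
    isCompact_Icc.inter_right (isOpen_interior.isClosed_compl.preimage hfc)
  have hBn : B.Nonempty := by
    rw [hseg, image_subset_iff, not_subset] at hcon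
    obtain ⟨s, hs, hs'⟩ := hcon
    exact ⟨s, hs, hs'⟩
  obtain ⟨s₀, ⟨hs₀, hs₀'⟩, hmin⟩ := hBc.exists_isLeast hBn
  have h0pos : 0 < s₀ := by
    rcases hs₀.1.lt_or_eq with h | h
    · exact h
    · exfalso; apply hs₀'; rw [← h]; simpa [hf] using hx
  have h1lt : s₀ < 1 := by
    rcases hs₀.2.lt_or_eq with h | h
    · exact h
    · exfalso; apply hs₀'; rw [h]; simpa [hf] using hy
  have hq : f s₀ ∈ segment ℝ x y := hseg ▸ mem_image_of_mem f hs₀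
  obtain ⟨W, hWo, hqW, hWc⟩ := hK (f s₀) (hxy hq) fun h => h0 (h ▸ hq)
  have hnear : ∀ᶠ s in 𝓝 s₀, f s ∈ W := hfc.continuousAt.eventually (hWo.mem_nhds hqW)
  obtain ⟨s₁, ⟨h1, h1'⟩, h1W⟩ := ((eventually_mem_set.2 (Ioo_mem_nhdsLT h0pos)).and
    (nhdsWithin_le_nhds hnear : ∀ᶠ s in 𝓝[<] s₀, f s ∈ W)).exists
  obtain ⟨s₂, ⟨h2, h2'⟩, h2W⟩ := ((eventually_mem_set.2 (Ioo_mem_nhdsGT h1lt)).and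
    (nhdsWithin_le_nhds hnear : ∀ᶠ s in 𝓝[>] s₀, f s ∈ W)).exists
  have hi1 : f s₁ ∈ interior K := by
    by_contra hc
    exact absurd (hmin ⟨⟨h1.le, (h1'.trans h1lt).le⟩, hc⟩) (not_le.2 h1')
  have hi1' : f s₁ ∈ interior (K ∩ W) := by
    rw [interior_inter, hWo.interior_eq]; exact ⟨hi1, h1W⟩
  have hk2 : f s₂ ∈ K := hxy (hseg ▸ mem_image_of_mem f ⟨(h0pos.trans h2).le, h2'.le⟩)
  have hmem : f s₀ ∈ openSegment ℝ (f s₁) (f s₂) := by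
    have : s₀ ∈ openSegment ℝ s₁ s₂ := by
      rw [openSegment_eq_Ioo (h1'.trans h2)]; exact ⟨h1', h2⟩
    have h3 := mem_image_of_mem (AffineMap.lineMap x y : ℝ →ᵃ[ℝ] E3) this
    rwa [image_openSegment] at h3
  exact hs₀' (interior_mono inter_subset_left
    (hWc.openSegment_interior_self_subset_interior hi1' ⟨hk2, h2W⟩ hmem))

lemma exists_notMem_span_pair {U : Set E3} (hU : IsOpen U) (hne : U.Nonempty) (x a b : E3) :
    ∃ w ∈ U, w ∉ Submodule.span ℝ {x, a} ∧ w ∉ Submodule.span ℝ {x, b} := by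
  have hnt : ∀ c : E3, Submodule.span ℝ {x, c} ≠ ⊤ := by
    intro c hc
    have h1 : Module.finrank ℝ (Submodule.span ℝ ({x, c} : Set E3)) ≤ 2 := by
      classical
      have := finrank_span_finset_le_card (R := ℝ) ({x, c} : Finset E3)
      have h2 := Finset.card_le_two (a := x) (b := c)
      simp only [Finset.coe_insert, Finset.coe_singleton] at this
      exact this.trans h2
    rw [hc, finrank_top] at h1
    simp at h1
  have hz : volume ((Submodule.span ℝ {x, a} : Set E3) ∪ (Submodule.span ℝ {x, b} : Set E3)) = 0 :=
    measure_union_null (Measure.addHaar_submodule _ _ (hnt a)) (Measure.addHaar_submodule _ _ (hnt b))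
  have hp : 0 < volume U := hU.measure_pos _ hne
  by_contra hcon
  push Not at hcon
  have : U ⊆ (Submodule.span ℝ {x, a} : Set E3) ∪ (Submodule.span ℝ {x, b} : Set E3) := by
    intro w hw
    by_cases h : w ∈ Submodule.span ℝ {x, a}
    · exact Or.inl h
    · exact Or.inr (hcon w hw h)
  exact absurd (measure_mono_null this hz) hp.ne'

lemma exists_notMem_span_singleton {U : Set E3} (hU : IsOpen U) (hne : U.Nonempty) (x : E3) :
    ∃ w ∈ U, w ∉ Submodule.span ℝ {x} := by
  obtain ⟨w, hw, h, -⟩ := exists_notMem_span_pair hU hne x x x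
  exact ⟨w, hw, by simpa using h⟩

lemma segment_disjoint_span {x a w : E3} (ha : a ∉ Submodule.span ℝ {x})
    (hw : w ∉ Submodule.span ℝ {x, a}) : ∀ z ∈ segment ℝ a w, z ∉ Submodule.span ℝ {x} := by
  rintro _ ⟨s, t, hs, ht, hst, rfl⟩ hz
  rcases ht.eq_or_lt with h | h
  · rw [← h, add_zero] at hst
    rw [← h, hst] at hz
    simp at hz
    exact ha hz
  · apply hw
    have h1 : Submodule.span ℝ {x} ≤ Submodule.span ℝ {x, a} := Submodule.span_mono (by simp)
    have h2 : a ∈ Submodule.span ℝ {x, a} := Submodule.subset_span (by simp)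
    have h3 := Submodule.sub_mem _ (h1 hz) (Submodule.smul_mem _ s h2)
    rw [add_sub_cancel_left] at h3
    exact (Submodule.smul_mem_iff _ h.ne').1 h3

lemma isPreconnected_ball_diff_span (c : E3) (ε : ℝ) (x : E3) :
    IsPreconnected (ball c ε \ (Submodule.span ℝ {x} : Set E3)) := by
  refine isPreconnected_of_forall_pair fun a ha b hb => ?_
  obtain ⟨w, hw, hwa, hwb⟩ := exists_notMem_span_pair isOpen_ball ⟨a, ha.1⟩ x a b
  refine ⟨segment ℝ a w ∪ segment ℝ w b, ?_, Or.inl (left_mem_segment _ _ _),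
    Or.inr (right_mem_segment _ _ _), ?_⟩
  · refine union_subset (fun z hz => ⟨(convex_ball c ε).segment_subset ha.1 hw hz,
      segment_disjoint_span ha.2 hwa z hz⟩) fun z hz => ⟨(convex_ball c ε).segment_subset hw hb.1 hz,
      segment_disjoint_span hb.2 hwb z (by rwa [segment_symm])⟩
  · exact (convex_segment a w).isPreconnected.union w (right_mem_segment _ _ _)
      (left_mem_segment _ _ _) (convex_segment w b).isPreconnected

/-- A line does not separate a connected open subset of three-space. -/
lemma IsPreconnected.diff_span {U : Set E3} (hU : IsPreconnected U) (hUo : IsOpen U) (x : E3) :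
    IsPreconnected (U \ (Submodule.span ℝ {x} : Set E3)) := by
  intro u v hu hv huv hnu hnv
  set D : Set E3 → Set E3 := fun u =>
    {y | ∃ ε > 0, ball y ε ⊆ U ∧ ball y ε \ (Submodule.span ℝ {x} : Set E3) ⊆ u} with hD
  have hDo : ∀ u, IsOpen (D u) := by
    intro u
    rw [Metric.isOpen_iff]
    rintro y ⟨ε, hε, h1, h2⟩
    refine ⟨ε / 2, by positivity, fun z hz => ⟨ε / 2, by positivity, ?_, ?_⟩⟩
    · exact (ball_subset_ball' (by rw [mem_ball] at hz; linarith)).trans h1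
    · exact (sdiff_subset_sdiff_left (ball_subset_ball' (by rw [mem_ball] at hz; linarith))).trans h2
  have hclosed : IsClosed (Submodule.span ℝ {x} : Set E3) := Submodule.closed_of_finiteDimensional _
  have hsub : ∀ u, IsOpen u → ((U \ (Submodule.span ℝ {x} : Set E3)) ∩ u).Nonempty →
      (U ∩ D u).Nonempty := by
    rintro u hu ⟨y, ⟨hyU, hyL⟩, hyu⟩
    obtain ⟨ε, hε, hb⟩ := Metric.isOpen_iff.1 (hUo.inter hu) y ⟨hyU, hyu⟩
    exact ⟨y, hyU, ε, hε, hb.trans inter_subset_left, sdiff_subset.trans (hb.trans inter_subset_right)⟩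
  by_contra hcon
  have hcov : U ⊆ D u ∪ D v := by
    intro y hy
    obtain ⟨ε, hε, hb⟩ := Metric.isOpen_iff.1 hUo y hy
    have hp := isPreconnected_ball_diff_span y ε x
    have hs : ball y ε \ (Submodule.span ℝ {x} : Set E3) ⊆ u ∪ v :=
      (sdiff_subset_sdiff_left hb).trans huv
    have hdis : ball y ε \ (Submodule.span ℝ {x} : Set E3) ∩ (u ∩ v) = ∅ := by
      rw [← not_nonempty_iff_eq_empty]
      exact fun h => hcon (h.mono (inter_subset_inter_left _ (sdiff_subset_sdiff_left hb)))
    rcases (isPreconnected_iff_subset_of_disjoint.1 hp) u v hu hv hs hdis with h | h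
    · exact Or.inl ⟨ε, hε, hb, h⟩
    · exact Or.inr ⟨ε, hε, hb, h⟩
  obtain ⟨y, hy, ⟨ε₁, hε₁, h1, h1'⟩, ⟨ε₂, hε₂, h2, h2'⟩⟩ :=
    hU (D u) (D v) (hDo u) (hDo v) hcov (hsub u hu hnu) (hsub v hv hnv)
  obtain ⟨w, hw, hwL⟩ := exists_notMem_span_singleton (U := ball y (min ε₁ ε₂)) isOpen_ball
    ⟨y, mem_ball_self (lt_min hε₁ hε₂)⟩ x
  have hw1 := ball_subset_ball (min_le_left _ _) hw
  have hw2 := ball_subset_ball (min_le_right _ _) hw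
  exact hcon ⟨w, ⟨h1 hw1, hwL⟩, h1' ⟨hw1, hwL⟩, h2' ⟨hw2, hwL⟩⟩

lemma mem_connectedComponentIn_of_segment {O : Set E3} {x y z : E3}
    (hy : y ∈ connectedComponentIn O x) (h : segment ℝ y z ⊆ O) :
    z ∈ connectedComponentIn O x := by
  rw [connectedComponentIn_eq hy]
  exact (convex_segment y z).isPreconnected.subset_connectedComponentIn (left_mem_segment _ _ _) h
    (right_mem_segment _ _ _)

lemma IsCone.segment_smul_subset {O : Set E3} (hO : IsCone O) {y : E3} (hy : y ∈ O) {t : ℝ}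
    (ht : 0 < t) : segment ℝ y (t • y) ⊆ O := by
  rintro _ ⟨a, b, ha, hb, hab, rfl⟩
  rw [smul_smul, ← add_smul]
  refine hO y hy _ ?_
  rcases ha.eq_or_lt with h | h
  · rw [← h, zero_add] at hab; rw [← h, hab]; linarith
  · positivity

lemma IsCone.connectedComponentIn {O : Set E3} (hO : IsCone O) (x : E3) :
    IsCone (connectedComponentIn O x) := fun _ hy _ ht =>
  mem_connectedComponentIn_of_segment hy
    (hO.segment_smul_subset (connectedComponentIn_subset _ _ hy) ht)

lemma isOpen_setOf_segment_subset {O : Set E3} (hO : IsOpen O) (x : E3) :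
    IsOpen {y | segment ℝ x y ⊆ O} := by
  have h : {y : E3 | segment ℝ x y ⊆ O} =
      {y | ∀ s ∈ Icc (0 : ℝ) 1, AffineMap.lineMap x y s ∈ O} := by
    ext y
    simp only [mem_ofPred_eq]
    rw [segment_eq_image_lineMap, image_subset_iff]; rfl
  rw [h, isOpen_iff_mem_nhds]
  intro y hy
  have hc : Continuous fun p : E3 × ℝ => (AffineMap.lineMap x p.1 p.2 : E3) := by
    simp only [AffineMap.lineMap_apply_module']; fun_prop
  refine isCompact_Icc.eventually_forall_of_forall_eventually fun s hs => ?_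
  exact hc.continuousAt.eventually (hO.mem_nhds (hy s hs))

/-- In a closed set that is locally convex off the origin, an interior point sees every point
of its component of the interior, except possibly those on the line through the origin. -/
lemma IsLocallyConvexOffOrigin.segment_subset {K : Set E3} (hK : IsLocallyConvexOffOrigin K)
    (hKc : IsClosed K) {x y : E3} (hx : x ∈ interior K)
    (hx0 : x ≠ 0) (hy : y ∈ connectedComponentIn (interior K) x) (hyx : y ∉ Submodule.span ℝ {x}) :
    segment ℝ x y ⊆ interior K := by
  set U := _root_.connectedComponentIn (interior K) x with hU
  have hUo : IsOpen U := isOpen_interior.connectedComponentIn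
  have hS := isPreconnected_connectedComponentIn.diff_span hUo x
  set V := {y : E3 | segment ℝ x y ⊆ interior K} with hV
  have hVo : IsOpen V := isOpen_setOf_segment_subset isOpen_interior x
  have hstep : ∀ z ∈ U \ (Submodule.span ℝ {x} : Set E3), z ∈ closure V → z ∈ V := by
    rintro z ⟨hzU, hzx⟩ hz
    refine hK.segment_subset_interior hx (connectedComponentIn_subset _ _ hzU) ?_ ?_
    · have : closure V ⊆ {y | segment ℝ x y ⊆ K} := by
        refine closure_minimal (fun y hy => hy.trans interior_subset) ?_
        have h : {y : E3 | segment ℝ x y ⊆ K} =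
            ⋂ s ∈ Icc (0 : ℝ) 1, {y | AffineMap.lineMap x y s ∈ K} := by
          ext y
          simp only [mem_ofPred_eq, mem_iInter]
          rw [segment_eq_image_lineMap, image_subset_iff]; rfl
        rw [h]
        refine isClosed_biInter fun s _ => hKc.preimage ?_
        simp only [AffineMap.lineMap_apply_module']; fun_prop
      exact this hz
    · rintro ⟨a, b, ha, hb, hab, h0⟩
      rcases hb.eq_or_lt with h | h
      · rw [← h, add_zero] at hab
        rw [← h, hab, zero_smul, add_zero, one_smul] at h0
        exact hx0 h0
      · apply hzx
        have : b • z = -a • x := by rw [neg_smul, eq_neg_iff_add_eq_zero, add_comm]; exact h0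
        rw [SetLike.mem_coe, ← Submodule.smul_mem_iff _ h.ne', this]
        exact Submodule.smul_mem _ _ (Submodule.mem_span_singleton_self x)
  by_contra hcon
  have hyV : y ∉ closure V := fun h => hcon (hstep y ⟨hy, hyx⟩ h)
  have hcov : U \ (Submodule.span ℝ {x} : Set E3) ⊆ V ∪ (closure V)ᶜ := by
    intro z hz
    by_cases h : z ∈ closure V
    · exact Or.inl (hstep z hz h)
    · exact Or.inr h
  obtain ⟨ε, hε, hb⟩ := Metric.isOpen_iff.1 isOpen_interior x hx
  obtain ⟨w, hw, hwx⟩ := exists_notMem_span_singleton (U := ball x ε) isOpen_ball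
    ⟨x, mem_ball_self hε⟩ x
  have hwV : w ∈ V := ((convex_ball x ε).segment_subset (mem_ball_self hε) hw).trans hb
  obtain ⟨z, -, h1, h2⟩ := hS V (closure V)ᶜ hVo isClosed_closure.isOpen_compl hcov
    ⟨w, ⟨mem_connectedComponentIn_of_segment (mem_connectedComponentIn hx) hwV, hwx⟩, hwV⟩
    ⟨y, ⟨hy, hyx⟩, hyV⟩
  exact h2 (subset_closure h1)

lemma zero_notMem_interior_compl {Γ : Set E3} (hcone : IsCone Γ) (hne : Γ.Nonempty) :
    (0 : E3) ∉ interior Γᶜ := by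
  intro h
  obtain ⟨g, hg⟩ := hne
  have h1 : Tendsto (fun s : ℝ => s • g) (𝓝[>] 0) (𝓝 0) := by
    have : ContinuousAt (fun s : ℝ => s • g) 0 := by fun_prop
    have h2 := this.tendsto
    rw [zero_smul] at h2
    exact h2.mono_left nhdsWithin_le_nhds
  obtain ⟨s, h2, h3⟩ := ((h1.eventually (isOpen_interior.mem_nhds h)).and
    self_mem_nhdsWithin).exists
  exact interior_subset h2 (hcone g hg s h3)

/-- Every component of the interior of the complement of `Γ` is convex. Two of its points that are
opposite with respect to the origin could be moved slightly in the direction of a point of `Γ`; the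
midpoint of the resulting segment would lie in `Γ`. -/
lemma convex_connectedComponentIn {Γ : Set E3} (hopen : IsOpen Γ) (hcone : IsCone Γ)
    (hne : Γ.Nonempty) (hK : IsLocallyConvexOffOrigin Γᶜ) (x₀ : E3) :
    Convex ℝ (connectedComponentIn (interior Γᶜ) x₀) := by
  set O := interior Γᶜ with hO
  set U := connectedComponentIn O x₀ with hU
  have h0 : (0 : E3) ∉ O := zero_notMem_interior_compl hcone hne
  have hOc : IsCone O := hcone.compl.interior
  have hUo : IsOpen U := isOpen_interior.connectedComponentIn
  have hUO : U ⊆ O := connectedComponentIn_subset _ _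
  have hsee : ∀ x ∈ U, ∀ y ∈ U, y ∉ Submodule.span ℝ {x} → segment ℝ x y ⊆ O := by
    intro x hx y hy hyx
    refine hK.segment_subset hopen.isClosed_compl (hUO hx)
      (fun h => h0 (h ▸ hUO hx)) ?_ hyx
    rw [← hO, ← connectedComponentIn_eq hx]
    exact hy
  have hanti : ∀ x ∈ U, -x ∉ U := by
    intro x hx hx'
    have hx0 : x ≠ 0 := fun h => h0 (h ▸ hUO hx)
    obtain ⟨g, hg, hgx⟩ := exists_notMem_span_singleton hopen hne x
    have t1 : Tendsto (fun s : ℝ => x + s • g) (𝓝[>] 0) (𝓝 x) := by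
      have : ContinuousAt (fun s : ℝ => x + s • g) 0 := by fun_prop
      have h2 := this.tendsto
      rw [zero_smul, add_zero] at h2
      exact h2.mono_left nhdsWithin_le_nhds
    have t2 : Tendsto (fun s : ℝ => -x + s • g) (𝓝[>] 0) (𝓝 (-x)) := by
      have : ContinuousAt (fun s : ℝ => -x + s • g) 0 := by fun_prop
      have h2 := this.tendsto
      rw [zero_smul, add_zero] at h2
      exact h2.mono_left nhdsWithin_le_nhds
    obtain ⟨s, h1, h2, h3⟩ := ((t1.eventually (hUo.mem_nhds hx)).and
      ((t2.eventually (hUo.mem_nhds hx')).and self_mem_nhdsWithin)).exists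
    have h3 : 0 < s := h3
    have hns : -x + s • g ∉ Submodule.span ℝ {x + s • g} := by
      rw [Submodule.mem_span_singleton]
      rintro ⟨c, hc⟩
      have e : ((1 - c) * s) • g = (1 + c) • x := by
        have : (1 + c) • x - ((1 - c) * s) • g = c • (x + s • g) - (-x + s • g) := by module
        rw [hc, sub_self, sub_eq_zero] at this
        exact this.symm
      by_cases hc1 : c = 1
      · rw [hc1] at e
        norm_num at e
        exact hx0 (by simpa using e.symm)
      · apply hgx
        have : (1 - c) * s ≠ 0 := mul_ne_zero (sub_ne_zero.2 (Ne.symm hc1)) h3.ne'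
        rw [← Submodule.smul_mem_iff _ this, e]
        exact Submodule.smul_mem _ _ (Submodule.mem_span_singleton_self x)
    have hmid : s • g ∈ segment ℝ (x + s • g) (-x + s • g) :=
      ⟨1 / 2, 1 / 2, by norm_num, by norm_num, by norm_num, by module⟩
    exact interior_subset (hsee _ h1 _ h2 hns hmid) (hcone g hg s h3)
  rw [convex_iff_segment_subset]
  intro x hx y hy
  have hseg : segment ℝ x y ⊆ O := by
    by_cases hyx : y ∈ Submodule.span ℝ {x}
    · obtain ⟨c, rfl⟩ := Submodule.mem_span_singleton.1 hyx
      rcases lt_trichotomy c 0 with hc | hc | hc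
      · exfalso
        have := hOc.connectedComponentIn x₀ _ hy (-c)⁻¹ (by
          rw [inv_pos]; linarith)
        rw [smul_smul, inv_neg, neg_mul, inv_mul_cancel₀ hc.ne, neg_one_smul] at this
        exact hanti x hx this
      · exfalso
        rw [hc, zero_smul] at hy
        exact h0 (hUO hy)
      · exact hOc.segment_smul_subset (hUO hx) hc
    · exact hsee x hx y hy hyx
  rw [hU, connectedComponentIn_eq hx]
  exact (convex_segment x y).isPreconnected.subset_connectedComponentIn (left_mem_segment _ _ _) hseg

/-! ### Supporting planes through a given line -/

lemma IsCone.zero_mem_closure {S : Set E3} (hS : IsCone S) (hne : S.Nonempty) :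
    (0 : E3) ∈ _root_.closure S := by
  obtain ⟨g, hg⟩ := hne
  have h1 : Tendsto (fun s : ℝ => s • g) (𝓝[>] 0) (𝓝 0) := by
    have : ContinuousAt (fun s : ℝ => s • g) 0 := by fun_prop
    have h2 := this.tendsto
    rw [zero_smul] at h2
    exact h2.mono_left nhdsWithin_le_nhds
  refine mem_closure_of_tendsto h1 ?_
  filter_upwards [self_mem_nhdsWithin] with s hs using hS g hg s hs

/-- A plane through the line `ℝ x` that misses the open convex set `S`. -/
lemma exists_normal_of_line {S : Set E3} (hSo : IsOpen S) (hS : Convex ℝ S) {x : E3}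
    (hx : ∀ s : ℝ, s • x ∉ S) (hne : S.Nonempty) :
    ∃ ν : E3, ν ≠ 0 ∧ ⟪ν, x⟫ = 0 ∧ ∀ y ∈ S, ⟪ν, y⟫ < 0 := by
  obtain ⟨f, c, h1, h2⟩ := geometric_hahn_banach_open hS hSo
    (Submodule.span ℝ {x}).convex (by
      rw [Set.disjoint_left]
      rintro y hy hyx
      obtain ⟨s, rfl⟩ := Submodule.mem_span_singleton.1 hyx
      exact hx s hy)
  have hfx : f x = 0 := by
    by_contra hfx
    have := h2 (((c - 1) / f x) • x) (Submodule.smul_mem _ _ (Submodule.mem_span_singleton_self x))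
    rw [map_smul, smul_eq_mul, div_mul_cancel₀ _ hfx] at this
    linarith
  have hc : c ≤ 0 := by simpa using h2 0 (Submodule.zero_mem _)
  have hf : ∀ y, ⟪(InnerProductSpace.toDual ℝ E3).symm f, y⟫ = f y := fun y =>
    InnerProductSpace.toDual_symm_apply
  refine ⟨(InnerProductSpace.toDual ℝ E3).symm f, ?_, by rw [hf, hfx], fun y hy => ?_⟩
  · obtain ⟨y, hy⟩ := hne
    intro h
    have h3 := hf y
    rw [h, inner_zero_left] at h3
    have := h1 y hy
    linarith
  · rw [hf]; exact (h1 y hy).trans_le hc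

/-- If neither `x` nor `-x` lies in the closure of the open convex cone `S`, then there is a
supporting plane of `S` through `x` that touches the closure of `S` along a ray on a prescribed side
of `x`. It is obtained by turning a plane that misses `S` about the line `ℝ x`, as far as
possible. -/
lemma exists_supporting_plane {S : Set E3} (hSo : IsOpen S) (hS : Convex ℝ S) (hcone : IsCone S)
    (hne : S.Nonempty) {x : E3} (hx : x ∉ closure S) (hx' : -x ∉ closure S) :
    ∃ p ∈ closure S, ∃ ν : E3, p ≠ 0 ∧ (∀ y ∈ closure S, ⟪ν, y⟫ ≤ 0) ∧ ⟪ν, p⟫ = 0 ∧ ⟪ν, x⟫ = 0 ∧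
      0 < tripleProduct p x ν := by
  have hcl : IsCone (closure S) := hcone.closure
  have hx0 : 0 < ‖x‖ := by
    rw [norm_pos_iff]
    rintro rfl
    exact hx (hcone.zero_mem_closure hne)
  have hline : ∀ s : ℝ, s ≠ 0 → s • x ∉ closure S := by
    intro s hs h
    rcases lt_or_gt_of_ne hs with h1 | h1
    · apply hx'
      rw [← hcl.smul_mem_iff (t := -s) (by linarith)]
      simpa using h
    · exact hx ((hcl.smul_mem_iff h1).1 h)
  have h0S : (0 : E3) ∉ S := by
    intro h
    obtain ⟨ε, hε, hb⟩ := Metric.isOpen_iff.1 hSo 0 h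
    refine hline (ε / (2 * ‖x‖)) (by positivity) (subset_closure (hb ?_))
    rw [mem_ball_zero_iff, norm_smul, Real.norm_of_nonneg (by positivity)]
    field_simp
    norm_num
  obtain ⟨ν₀, hν₀, hν₀x, hν₀S⟩ := exists_normal_of_line hSo hS (x := x) (fun s h => by
    by_cases hs : s = 0
    · rw [hs, zero_smul] at h; exact h0S h
    · exact hline s hs (subset_closure h)) hne
  have hnν : 0 < ‖ν₀‖ := norm_pos_iff.2 hν₀
  obtain ⟨b, hb0, hb2, hb⟩ := exists_frame (p := ‖x‖⁻¹ • x) (n := ‖ν₀‖⁻¹ • ν₀)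
    (by rw [norm_smul, norm_inv, norm_norm, inv_mul_cancel₀ hx0.ne'])
    (by rw [norm_smul, norm_inv, norm_norm, inv_mul_cancel₀ hnν.ne'])
    (by rw [inner_smul_left, inner_smul_right, real_inner_comm, hν₀x]; simp)
  have hxb : x = frameVec b ‖x‖ 0 0 := by
    rw [frameVec, hb0, smul_smul, mul_inv_cancel₀ hx0.ne']; simp
  have hS2 : ∀ y ∈ S, ⟪b 2, y⟫ < 0 := by
    intro y hy
    rw [hb2, inner_smul_left]
    exact mul_neg_of_pos_of_neg (by simpa using hν₀) (hν₀S y hy)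
  -- `A θ` is the linear form of the plane turned by the angle `θ` about the line `ℝ x`, and `Θ` is
  -- the set of angles at which the plane still supports `S`
  set A : ℝ → E3 → ℝ := fun θ y => Real.cos θ * ⟪b 2, y⟫ - Real.sin θ * ⟪b 1, y⟫ with hA
  have hAc : ∀ y, Continuous fun θ => A θ y := fun y => by simp only [hA]; fun_prop
  set Θ : Set ℝ := Icc 0 Real.pi ∩ {θ | ∀ y ∈ closure S, A θ y ≤ 0} with hΘ
  have hΘc : IsCompact Θ := by
    refine isCompact_Icc.inter_right ?_
    have : {θ | ∀ y ∈ closure S, A θ y ≤ 0} = ⋂ y ∈ closure S, {θ | A θ y ≤ 0} := by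
      ext; simp
    rw [this]
    exact isClosed_biInter fun y _ => isClosed_le (hAc y) continuous_const
  have hAy : ∀ θ, Continuous (A θ) := fun θ => by simp only [hA]; fun_prop
  have hΘ0 : (0 : ℝ) ∈ Θ := by
    refine ⟨⟨le_rfl, Real.pi_pos.le⟩, fun y hy => ?_⟩
    have : closure S ⊆ {y | A 0 y ≤ 0} := closure_minimal (fun z hz => by
      simpa [hA] using (hS2 z hz).le) (isClosed_le (hAy 0) continuous_const)
    exact this hy
  obtain ⟨θ, ⟨⟨hθ0, hθπ⟩, hθS⟩, hmax⟩ := hΘc.exists_isGreatest ⟨0, hΘ0⟩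
  have hθlt : θ < Real.pi := by
    rcases hθπ.lt_or_eq with h | h
    · exact h
    · exfalso
      obtain ⟨y, hy⟩ := hne
      have h1 := hθS y (subset_closure hy)
      have h2 := hS2 y hy
      simp only [hA, h, Real.cos_pi, Real.sin_pi] at h1
      linarith
  -- the derivative of `A` at the extremal angle
  set m : E3 → ℝ := fun y => -Real.sin θ * ⟪b 2, y⟫ - Real.cos θ * ⟪b 1, y⟫ with hm
  have hmc : Continuous m := by simp only [hm]; fun_prop
  set d : ℕ → ℝ := fun n => (Real.pi - θ) / (n + 2) with hd
  have hdpos : ∀ n, 0 < d n := fun n => div_pos (by linarith) (by positivity)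
  have hdle : ∀ n, d n ≤ (Real.pi - θ) / 2 := fun n =>
    div_le_div_of_nonneg_left (by linarith) (by norm_num) (by
      have : (0 : ℝ) ≤ n := n.cast_nonneg
      linarith)
  -- beyond the extremal angle the plane cuts `S`; the point of contact is a limit of such points
  have hex : ∀ n, ∃ y ∈ closure S ∩ sphere 0 1, 0 < A (θ + d n) y := by
    intro n
    have hn : θ + d n ∉ Θ := fun h => by
      have := hmax h
      linarith [hdpos n]
    have : ∃ y ∈ closure S, 0 < A (θ + d n) y := by
      by_contra hcon
      push Not at hcon
      exact hn ⟨⟨by linarith [hdpos n], by linarith [hdle n]⟩, hcon⟩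
    obtain ⟨y, hy, hy'⟩ := this
    have hy0 : 0 < ‖y‖ := by
      rw [norm_pos_iff]; rintro rfl
      simp [hA] at hy'
    refine ⟨‖y‖⁻¹ • y, ⟨hcl y hy _ (inv_pos.2 hy0), ?_⟩, ?_⟩
    · rw [mem_sphere_zero_iff_norm, norm_smul, norm_inv, norm_norm, inv_mul_cancel₀ hy0.ne']
    · have : A (θ + d n) (‖y‖⁻¹ • y) = ‖y‖⁻¹ * A (θ + d n) y := by
        simp only [hA, inner_smul_right]; ring
      rw [this]; positivity
  choose y hy hy' using hex
  obtain ⟨p, ⟨hpS, hp1⟩, φ, hφ, hlim⟩ :=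
    ((isCompact_sphere (0 : E3) 1).inter_left isClosed_closure).tendsto_subseq hy
  have hp0 : p ≠ 0 := by
    rintro rfl
    simp at hp1
  have hd0 : Tendsto d atTop (𝓝 0) := by
    have h1 : Tendsto (fun n : ℕ => (n : ℝ) + 2) atTop atTop :=
      tendsto_atTop_add_const_right _ _ tendsto_natCast_atTop_atTop
    exact tendsto_const_nhds.div_atTop h1
  have hAp : A θ p = 0 := by
    refine le_antisymm (hθS p hpS) ?_
    have hcont : Continuous fun q : ℝ × E3 => A q.1 q.2 := by simp only [hA]; fun_prop
    have h1 : Tendsto (fun n => (θ + d (φ n), y (φ n))) atTop (𝓝 (θ, p)) := by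
      refine Tendsto.prodMk_nhds ?_ hlim
      simpa using (hd0.comp hφ.tendsto_atTop).const_add θ
    exact ge_of_tendsto' ((hcont.tendsto (θ, p)).comp h1) fun n => (hy' _).le
  have hmp : 0 ≤ m p := by
    refine ge_of_tendsto' ((hmc.tendsto p).comp hlim) fun n => ?_
    have h1 := hy' (φ n)
    have h2 := hθS _ (hy (φ n)).1
    have h3 : A (θ + d (φ n)) (y (φ n)) =
        Real.cos (d (φ n)) * A θ (y (φ n)) + Real.sin (d (φ n)) * m (y (φ n)) := by
      simp only [hA, hm, Real.cos_add, Real.sin_add]; ring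
    have h4 : 0 ≤ Real.cos (d (φ n)) :=
      Real.cos_nonneg_of_mem_Icc ⟨by linarith [hdpos (φ n), Real.pi_pos], by linarith [hdle (φ n)]⟩
    have h5 : 0 < Real.sin (d (φ n)) :=
      Real.sin_pos_of_pos_of_lt_pi (hdpos _) (by linarith [hdle (φ n), Real.pi_pos])
    rw [h3] at h1
    have h6 := mul_nonpos_of_nonneg_of_nonpos h4 h2
    exact (pos_of_mul_pos_right (by linarith : 0 < Real.sin (d (φ n)) * m (y (φ n))) h5.le).le
  have hmp' : m p ≠ 0 := by
    intro h0
    simp only [hm] at h0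
    simp only [hA] at hAp
    have hcs := Real.sin_sq_add_cos_sq θ
    have e2 : ⟪b 2, p⟫ = 0 := by
      linear_combination (-⟪b 2, p⟫) * hcs + Real.cos θ * hAp - Real.sin θ * h0
    have e1 : ⟪b 1, p⟫ = 0 := by
      linear_combination (-⟪b 1, p⟫) * hcs - Real.sin θ * hAp - Real.cos θ * h0
    have e : p = (⟪b 0, p⟫ * ‖x‖⁻¹) • x := by
      conv_lhs => rw [← frameVec_inner b p, e1, e2]
      rw [frameVec, mul_smul, ← hb0]; simp
    refine hline (⟪b 0, p⟫ * ‖x‖⁻¹) ?_ (e ▸ hpS)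
    intro h
    rw [h, zero_smul] at e
    exact hp0 e
  have hν : ∀ y, ⟪frameVec b 0 (-Real.sin θ) (Real.cos θ), y⟫ = A θ y := fun y => by
    rw [real_inner_comm, inner_frameVec]
    simp only [hA, real_inner_comm]; ring
  refine ⟨p, hpS, frameVec b 0 (-Real.sin θ) (Real.cos θ), hp0, fun y hy => ?_, ?_, ?_, ?_⟩
  · rw [hν]; exact hθS y hy
  · rw [hν]; exact hAp
  · rw [hxb, frameVec_inner_frameVec]; ring
  · have e : tripleProduct p x (frameVec b 0 (-Real.sin θ) (Real.cos θ)) = ‖x‖ * m p := by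
      conv_lhs => rw [← frameVec_inner b p]
      nth_rewrite 1 [hxb]
      rw [tripleProduct_frameVec b _ _ _ _ _ _ _ _ _ hb]
      simp only [hm]; ring
    rw [e]
    exact mul_pos hx0 (lt_of_le_of_ne hmp hmp'.symm)

namespace BoundaryChart

/-- The union of the open tangent half planes of the boundary cone at the parameters in `T`, each
bounded by the generator through the boundary curve. -/
def sweep {Γ : Set E3} (C : BoundaryChart Γ) (T : Set ℝ) : Set E3 :=
  {x | ∃ t ∈ T, ∃ r s : ℝ, 0 < s ∧ x = r • C.curve t + s • C.tangent t}

end BoundaryChart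

/-- Points of `Γ` lie on an open tangent half plane of the boundary of any component `U` of the
interior of the complement, unless they are opposite to the closure of `U`. -/
lemma exists_mem_sweep {Γ : Set E3} (hopen : IsOpen Γ) (hcone : IsCone Γ) (hne : Γ.Nonempty)
    (hsmooth : HasSmoothBoundaryOffOrigin Γ)
    (hH : ∀ p ∈ frontier Γ, p ≠ 0 → 0 ≤ meanCurvature Γ p) {x₁ x : E3} (hx₁ : x₁ ∈ interior Γᶜ)
    (hx : x ∈ Γ) (hx' : -x ∉ closure (connectedComponentIn (interior Γᶜ) x₁)) :
    ∃ p ∈ frontier Γ, p ≠ 0 ∧ ∀ C : BoundaryChart Γ, p ∈ C.box →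
      x ∈ C.sweep {⟪C.b 1, p⟫ / ⟪C.b 0, p⟫} := by
  have hK := isLocallyConvexOffOrigin_compl hcone hsmooth hH
  set O := interior Γᶜ with hO
  set U := connectedComponentIn O x₁ with hU
  have hUo : IsOpen U := isOpen_interior.connectedComponentIn
  have hUO : U ⊆ O := connectedComponentIn_subset _ _
  have hUc : Convex ℝ U := convex_connectedComponentIn hopen hcone hne hK x₁
  have hUcone : IsCone U := hcone.compl.interior.connectedComponentIn x₁
  have hclU : closure U ⊆ Γᶜ :=
    closure_minimal (hUO.trans interior_subset) hopen.isClosed_compl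
  obtain ⟨p, hpU, ν, hp0, hνU, hνp, hνx, htrip⟩ := exists_supporting_plane hUo hUc hUcone
    ⟨x₁, mem_connectedComponentIn hx₁⟩ (fun h => hclU h hx) hx'
  have hν0 : ν ≠ 0 := by
    rintro rfl
    simp [tripleProduct] at htrip
  have hpO : p ∉ O := by
    intro h
    have hV : IsOpen (connectedComponentIn O p) := isOpen_interior.connectedComponentIn
    obtain ⟨z, hz1, hz2⟩ := mem_closure_iff.1 hpU _ hV (mem_connectedComponentIn h)
    have e : connectedComponentIn O p = U := by
      rw [connectedComponentIn_eq hz1, hU, connectedComponentIn_eq hz2]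
    have hpU' : p ∈ U := e ▸ mem_connectedComponentIn h
    have t1 : Tendsto (fun s : ℝ => p + s • ν) (𝓝[>] 0) (𝓝 p) := by
      have : ContinuousAt (fun s : ℝ => p + s • ν) 0 := by fun_prop
      have h2 := this.tendsto
      rw [zero_smul, add_zero] at h2
      exact h2.mono_left nhdsWithin_le_nhds
    obtain ⟨s, hs, hs0⟩ := ((t1.eventually (hUo.mem_nhds hpU')).and self_mem_nhdsWithin).exists
    have h3 := hνU _ (subset_closure hs)
    rw [inner_add_right, inner_smul_right, hνp, zero_add, real_inner_self_eq_norm_sq] at h3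
    have : 0 < ‖ν‖ := norm_pos_iff.2 hν0
    have hs0 : 0 < s := hs0
    have : 0 < s * ‖ν‖ ^ 2 := by positivity
    linarith
  have hpf : p ∈ frontier Γ := by
    rw [← frontier_compl]
    exact ⟨subset_closure (hclU hpU), hpO⟩
  refine ⟨p, hpf, hp0, fun C hC => ?_⟩
  -- inside the box there is only one component
  have hsub : O ∩ C.box ⊆ U := by
    obtain ⟨z, hz1, hz2⟩ := mem_closure_iff.1 hpU _ C.isOpen_box hC
    have h1 : Convex ℝ (O ∩ C.box) := by
      have := (C.convex_compl_inter_box hsmooth hH).interior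
      rwa [interior_inter, C.isOpen_box.interior_eq] at this
    rw [hU, connectedComponentIn_eq hz2]
    exact h1.isPreconnected.subset_connectedComponentIn ⟨hUO hz2, hz1⟩ inter_subset_left
  have hbox : ∀ z ∈ C.box, z ∈ Γᶜ → ⟪ν, z⟫ ≤ 0 := by
    intro z hz hzK
    have h1 := compl_subset_closure_interior hcone hsmooth hzK (C.ne_zero_of_mem_box hz)
    have h2 := C.isOpen_box.inter_closure ⟨hz, h1⟩
    rw [inter_comm] at h2
    exact hνU _ (closure_mono hsub h2)
  have ht := C.mem_Ioo_of_mem_box hC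
  have hpe := C.eq_smul_curve hC hpf
  have hr := hC.1
  set t := ⟪C.b 1, p⟫ / ⟪C.b 0, p⟫ with htdef
  set r₀ := ⟪C.b 0, p⟫ with hr₀
  have hcurve : ∀ s ∈ Ioo (-C.δ) C.δ, ⟪ν, C.curve s⟫ ≤ 0 := by
    intro s hs
    have h1 := C.smul_curve_mem_box one_pos hs
    have h2 := C.smul_curve_mem_frontier one_pos hs
    rw [one_smul] at h1 h2
    refine hbox _ h1 fun h => ?_
    rw [hopen.frontier_eq] at h2
    exact h2.2 h
  have hct : ⟪ν, C.curve t⟫ = 0 := by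
    rw [hpe, inner_smul_right] at hνp
    exact (mul_eq_zero.1 hνp).resolve_left hr.ne'
  have hmaxi : IsLocalMax (fun s => ⟪ν, C.curve s⟫) t := by
    filter_upwards [isOpen_Ioo.mem_nhds ht] with s hs
    rw [hct]; exact hcurve s hs
  have hνt : ⟪ν, C.tangent t⟫ = 0 := by
    have h1 : HasDerivAt (fun s => ⟪ν, C.curve s⟫) ⟪ν, C.tangent t⟫ t := by
      have := (hasDerivAt_const t ν).inner ℝ (C.hasDerivAt_curve ht)
      simpa using this
    exact hmaxi.hasDerivAt_eq_zero h1
  have hν2 : 0 ≤ ⟪ν, C.b 2⟫ := by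
    have t1 : Tendsto (fun s : ℝ => p - s • C.b 2) (𝓝[>] 0) (𝓝 p) := by
      have : ContinuousAt (fun s : ℝ => p - s • C.b 2) 0 := by fun_prop
      have h2 := this.tendsto
      rw [zero_smul, sub_zero] at h2
      exact h2.mono_left nhdsWithin_le_nhds
    obtain ⟨s, hs, hs0⟩ := ((t1.eventually (C.isOpen_box.mem_nhds hC)).and
      self_mem_nhdsWithin).exists
    have hs0 : 0 < s := hs0
    have h2 : p - s • C.b 2 ∈ Γᶜ := by
      rw [C.mem_compl_box_iff hs]
      have h3 := (C.mem_frontier_iff hC).1 hpf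
      simp only [inner_sub_right, inner_smul_right, inner_frame]
      simp
      linarith
    have h3 := hbox _ hs h2
    rw [inner_sub_right, inner_smul_right, hνp] at h3
    exact nonneg_of_mul_nonneg_right (by linarith : 0 ≤ s * ⟪ν, C.b 2⟫) hs0
  obtain ⟨n₀, n₁, n₂, hn⟩ := exists_frameVec C.b ν
  obtain ⟨y₀, y₁, y₂, hy⟩ := exists_frameVec C.b x
  rw [hn, BoundaryChart.curve, frameVec_inner_frameVec] at hct
  rw [hn, BoundaryChart.tangent, frameVec_inner_frameVec] at hνt
  rw [hn, real_inner_comm, inner_frameVec_two] at hν2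
  rw [hn, hy, frameVec_inner_frameVec] at hνx
  have e1 : n₁ = -(n₂ * deriv C.u t) := by linarith
  have e0 : n₀ = n₂ * (t * deriv C.u t - C.u t) := by rw [e1] at hct; linarith
  have hn2 : 0 < n₂ := by
    rcases hν2.lt_or_eq with h | h
    · exact h
    · exfalso; apply hν0
      rw [hn, e0, e1, ← h]; simp [frameVec]
  have ey : y₂ = -((t * deriv C.u t - C.u t) * y₀) + deriv C.u t * y₁ := by
    rw [e0, e1] at hνx
    have : n₂ * (y₂ - (-((t * deriv C.u t - C.u t) * y₀) + deriv C.u t * y₁)) = 0 := by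
      linear_combination hνx
    have := (mul_eq_zero.1 this).resolve_left hn2.ne'
    linarith
  refine ⟨t, rfl, y₀, y₁ - t * y₀, ?_, ?_⟩
  · rw [hpe, hn, hy, BoundaryChart.curve, smul_frameVec, tripleProduct_frameVec _ _ _ _ _ _ _ _ _ _
      C.pos, e0, e1, ey] at htrip
    have e : (y₁ - t * y₀) * (r₀ * n₂ *
        ((t * deriv C.u t - C.u t) ^ 2 + deriv C.u t ^ 2 + 1)) > 0 := by
      refine htrip.trans_eq ?_
      ring
    exact pos_of_mul_pos_left e (by positivity)
  · rw [hy, BoundaryChart.curve, BoundaryChart.tangent, smul_frameVec, smul_frameVec, frameVec_add,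
      ey]
    congr 1 <;> ring

/-! ### The volume swept by the tangent half planes -/

open scoped ENNReal NNReal

lemma lintegral_fin_three_mul {f g h : ℝ → ℝ≥0∞} (hf : Measurable f) (hg : Measurable g)
    (hh : Measurable h) :
    ∫⁻ v : Fin 3 → ℝ, f (v 0) * (g (v 1) * h (v 2)) =
      (∫⁻ r, f r) * ((∫⁻ t, g t) * ∫⁻ s, h s) := by
  have h1 := (volume_preserving_piFinSuccAbove (fun _ : Fin 3 => ℝ) 0).symm
  rw [← h1.lintegral_comp_emb (MeasurableEquiv.measurableEmbedding _)]
  have h2 := (volume_preserving_finTwoArrow ℝ).symm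
  have e : ∀ p : ℝ × (Fin 2 → ℝ),
      f ((MeasurableEquiv.piFinSuccAbove (fun _ : Fin 3 => ℝ) 0).symm p 0) *
        (g ((MeasurableEquiv.piFinSuccAbove (fun _ : Fin 3 => ℝ) 0).symm p 1) *
          h ((MeasurableEquiv.piFinSuccAbove (fun _ : Fin 3 => ℝ) 0).symm p 2)) =
      f p.1 * (g (p.2 0) * h (p.2 1)) := fun p => by
    simp [MeasurableEquiv.piFinSuccAbove, Fin.insertNthEquiv]
    rfl
  simp_rw [e]
  rw [Measure.volume_eq_prod, lintegral_prod_mul (f := f)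
    (g := fun q : Fin 2 → ℝ => g (q 0) * h (q 1)) hf.aemeasurable (by fun_prop)]
  congr 1
  rw [← h2.lintegral_comp_emb (MeasurableEquiv.measurableEmbedding _)]
  have e2 : ∀ p : ℝ × ℝ, g (MeasurableEquiv.finTwoArrow.symm p 0) *
      h (MeasurableEquiv.finTwoArrow.symm p 1) = g p.1 * h p.2 := fun p => by
    simp [MeasurableEquiv.finTwoArrow]
  simp_rw [e2]
  rw [Measure.volume_eq_prod, lintegral_prod_mul hg.aemeasurable hh.aemeasurable]

namespace BoundaryChart

variable {Γ : Set E3} (C : BoundaryChart Γ)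

/-- The coordinates of `r γ(t) + s γ'(t)` in the frame, as a function of `(r, t, s)`. -/
noncomputable def sweepMap (v : Fin 3 → ℝ) : Fin 3 → ℝ :=
  ![v 0, v 0 * v 1 + v 2, v 0 * C.u (v 1) + v 2 * deriv C.u (v 1)]

lemma hasFDerivAt_sweepMap {v : Fin 3 → ℝ} (hv : v 1 ∈ Ioo (-C.δ) C.δ) :
    HasFDerivAt C.sweepMap (LinearMap.toContinuousLinearMap (Matrix.toLin'
      !![1, 0, 0; v 1, v 0, 1;
        C.u (v 1), v 0 * deriv C.u (v 1) + v 2 * deriv (deriv C.u) (v 1), deriv C.u (v 1)])) v := by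
  rw [hasFDerivAt_pi']
  have p0 : HasFDerivAt (fun w : Fin 3 → ℝ => w 0) _ v := hasFDerivAt_apply (𝕜 := ℝ) 0 v
  have p1 : HasFDerivAt (fun w : Fin 3 → ℝ => w 1) _ v := hasFDerivAt_apply (𝕜 := ℝ) 1 v
  have p2 : HasFDerivAt (fun w : Fin 3 → ℝ => w 2) _ v := hasFDerivAt_apply (𝕜 := ℝ) 2 v
  have q1 := (C.hasDerivAt_u hv).comp_hasFDerivAt v p1
  have q2 := (C.hasDerivAt_deriv_u hv).comp_hasFDerivAt v p1
  intro i
  fin_cases i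
  · refine p0.congr_fderiv ?_
    ext w
    simp [dotProduct, Fin.sum_univ_three]
  · refine ((p0.mul p1).add p2).congr_fderiv ?_
    ext w
    simp [dotProduct, Fin.sum_univ_three]
    ring
  · refine ((p0.mul q1).add (p2.mul q2)).congr_fderiv ?_
    ext w
    simp [dotProduct, Fin.sum_univ_three]
    ring

/-- The total curvature of the boundary curve over the parameters in `T`, up to a factor close to
one. -/
noncomputable def bend (T : Set ℝ) : ℝ≥0∞ :=
  ∫⁻ t in T, ENNReal.ofReal |deriv (deriv C.u) t|

/-- The Jacobian of `(r, t, s) ↦ r γ(t) + s γ'(t)` is `-s u''(t)`, so the volume swept out by the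
tangent half planes is controlled by the curvature. -/
lemma volume_sweep_inter_ball_le {T : Set ℝ} (hT : MeasurableSet T) (hTs : T ⊆ Ioo (-C.δ) C.δ) :
    volume (C.sweep T ∩ ball 0 1) ≤ ENNReal.ofReal (103 / 100) * C.bend T := by
  set D : Set (Fin 3 → ℝ) :=
    {v | v 0 ∈ Ioo (-1 : ℝ) 1 ∧ v 1 ∈ T ∧ v 2 ∈ Ioo (0 : ℝ) (101 / 100)} with hD
  have hDm : MeasurableSet D :=
    (measurableSet_Ioo.preimage (measurable_pi_apply 0)).inter
      ((hT.preimage (measurable_pi_apply 1)).inter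
        (measurableSet_Ioo.preimage (measurable_pi_apply 2)))
  set Φ : E3 ≃ᵐ (Fin 3 → ℝ) := C.b.measurableEquiv.trans (MeasurableEquiv.toLp 2 (Fin 3 → ℝ)).symm
    with hΦ
  have hΦi : ∀ x i, Φ x i = ⟪C.b i, x⟫ := fun x i => by
    simp [hΦ, OrthonormalBasis.measurableEquiv, OrthonormalBasis.repr_apply_apply]
  have hΦm : MeasurePreserving Φ volume volume :=
    (PiLp.volume_preserving_ofLp (Fin 3)).comp C.b.measurePreserving_measurableEquiv
  have h1 : C.sweep T ∩ ball 0 1 ⊆ Φ ⁻¹' (C.sweepMap '' D) := by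
    rintro _ ⟨⟨t, ht, r, s, hs, rfl⟩, hx⟩
    have htδ := abs_lt.2 (hTs ht)
    have hδ := C.δ_le
    have hcoord : r • C.curve t + s • C.tangent t =
        frameVec C.b r (r * t + s) (r * C.u t + s * deriv C.u t) := by
      rw [curve, tangent, smul_frameVec, smul_frameVec, frameVec_add]
      congr 1 <;> ring
    rw [hcoord] at hx ⊢
    rw [mem_ball_zero_iff] at hx
    have hx2 := norm_sq_frameVec C.b r (r * t + s) (r * C.u t + s * deriv C.u t)
    have hx3 : ‖frameVec C.b r (r * t + s) (r * C.u t + s * deriv C.u t)‖ ^ 2 < 1 := by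
      nlinarith [norm_nonneg (frameVec C.b r (r * t + s) (r * C.u t + s * deriv C.u t))]
    have hr : |r| < 1 := by
      rw [← sq_lt_one_iff_abs_lt_one]
      nlinarith [sq_nonneg (r * t + s), sq_nonneg (r * C.u t + s * deriv C.u t)]
    have hs1 : |r * t + s| < 1 := by
      rw [← sq_lt_one_iff_abs_lt_one]
      nlinarith [sq_nonneg r, sq_nonneg (r * C.u t + s * deriv C.u t)]
    have hrt : |r * t| ≤ 1 / 100 := by
      rw [abs_mul]
      nlinarith [abs_nonneg r, abs_nonneg t]
    refine ⟨![r, t, s], ⟨abs_lt.1 hr, ht, hs, ?_⟩, ?_⟩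
    · have := (abs_lt.1 hs1).2
      have := (abs_le.1 hrt).1
      simp only [Matrix.cons_val]
      linarith
    · ext i
      rw [hΦi]
      fin_cases i <;> simp [sweepMap]
  have h2 : volume (C.sweep T ∩ ball 0 1) ≤ volume (C.sweepMap '' D) := by
    rw [← hΦm.measure_preimage_equiv]
    exact measure_mono h1
  refine h2.trans ((addHaar_image_le_lintegral_abs_det_fderiv volume hDm fun v hv =>
    (C.hasFDerivAt_sweepMap (hTs hv.2.1)).hasFDerivWithinAt).trans ?_)
  have h3 : ∀ v ∈ D, ENNReal.ofReal |(LinearMap.toContinuousLinearMap (Matrix.toLin'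
      !![1, 0, 0; v 1, v 0, 1;
        C.u (v 1), v 0 * deriv C.u (v 1) + v 2 * deriv (deriv C.u) (v 1),
          deriv C.u (v 1)])).det| =
      (Ioo (-1 : ℝ) 1).indicator 1 (v 0) *
        (T.indicator (fun t => ENNReal.ofReal |deriv (deriv C.u) t|) (v 1) *
          (Ioo (0 : ℝ) (101 / 100)).indicator ENNReal.ofReal (v 2)) := by
    intro v hv
    rw [indicator_of_mem hv.1, indicator_of_mem hv.2.1, indicator_of_mem hv.2.2,
      LinearMap.det_toContinuousLinearMap, LinearMap.det_toLin', Matrix.det_fin_three,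
      ← ENNReal.ofReal_mul (abs_nonneg _), Pi.one_apply, one_mul]
    congr 1
    rw [← abs_of_pos hv.2.2.1, ← abs_mul, ← abs_neg]
    congr 1
    simp only [Matrix.of_apply, Matrix.cons_val', Matrix.cons_val]
    rw [abs_of_pos hv.2.2.1]
    ring
  rw [setLIntegral_congr_fun hDm h3]
  refine (setLIntegral_le_lintegral _ _).trans ?_
  have hm2 : Measurable (fun t => ENNReal.ofReal |deriv (deriv C.u) t|) :=
    ((measurable_deriv _).abs).ennreal_ofReal
  rw [lintegral_fin_three_mul (measurable_one.indicator measurableSet_Ioo) (hm2.indicator hT)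
    (ENNReal.measurable_ofReal.indicator measurableSet_Ioo), lintegral_indicator hT,
    lintegral_indicator measurableSet_Ioo, lintegral_indicator measurableSet_Ioo, ← bend]
  have i1 : ∫⁻ r in Ioo (-1 : ℝ) 1, (1 : ℝ → ℝ≥0∞) r = ENNReal.ofReal 2 := by
    simp only [Pi.one_apply, lintegral_const, Measure.restrict_apply_univ, Real.volume_Ioo]
    norm_num
  have i2 : ∫⁻ s in Ioo (0 : ℝ) (101 / 100), ENNReal.ofReal s =
      ENNReal.ofReal ((101 / 100) ^ 2 / 2) := by
    rw [← ofReal_integral_eq_lintegral_ofReal]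
    · rw [← integral_Ioc_eq_integral_Ioo, ← intervalIntegral.integral_of_le (by norm_num),
        integral_id]
      norm_num
    · exact (continuous_id.integrableOn_Icc (a := (0 : ℝ)) (b := 101 / 100)).mono_set
        Ioo_subset_Icc_self
    · filter_upwards [ae_restrict_mem measurableSet_Ioo] with s hs using hs.1.le
  rw [i1, i2, mul_comm (C.bend T), ← mul_assoc, ← ENNReal.ofReal_mul (by norm_num)]
  gcongr
  norm_num

end BoundaryChart

/-! ### The curvature integral over the boundary -/

/-- A `1`-Lipschitz projection to the plane does not increase area. -/
lemma volume_image_le_euclideanHausdorffMeasure {π : E3 → EuclideanSpace ℝ (Fin 2)}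
    (hπ : LipschitzWith 1 π) (A : Set E3) : volume (π '' A) ≤ μHE[2] A := by
  rw [← EuclideanSpace.euclideanHausdorffMeasure_eq_volume 2,
    Measure.euclideanHausdorffMeasure_def, Measure.euclideanHausdorffMeasure_def,
    Measure.smul_apply, Measure.smul_apply]
  gcongr
  simpa using hπ.hausdorffMeasure_image_le (d := 2) (by norm_num) A

lemma euclideanHausdorffMeasure_lt_top {A : Set E3} {Q : Set (ℝ × ℝ)} {Ψ : ℝ × ℝ → E3} {K : ℝ≥0}
    (hΨ : LipschitzOnWith K Ψ Q) (hQ : volume Q < ⊤) (hA : A ⊆ Ψ '' Q) :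
    (μHE[2] : Measure E3) A < ⊤ := by
  have h1 : (μH[2] : Measure E3) A < ⊤ := by
    refine ((measure_mono hA).trans (hΨ.hausdorffMeasure_image_le (by norm_num))).trans_lt ?_
    rw [hausdorffMeasure_prod_real]
    exact ENNReal.mul_lt_top (by simp) hQ
  rw [Measure.euclideanHausdorffMeasure_def, Measure.smul_apply, ENNReal.smul_def, smul_eq_mul]
  exact ENNReal.mul_lt_top (by simp) (by simpa using h1)

lemma lintegral_fin_two_mul {f g : ℝ → ℝ≥0∞} (hf : Measurable f) (hg : Measurable g) :
    ∫⁻ v : Fin 2 → ℝ, f (v 0) * g (v 1) = (∫⁻ r, f r) * ∫⁻ t, g t := by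
  have h2 := (volume_preserving_finTwoArrow ℝ).symm
  rw [← h2.lintegral_comp_emb (MeasurableEquiv.measurableEmbedding _)]
  have e2 : ∀ p : ℝ × ℝ, f (MeasurableEquiv.finTwoArrow.symm p 0) *
      g (MeasurableEquiv.finTwoArrow.symm p 1) = f p.1 * g p.2 := fun p => by
    simp [MeasurableEquiv.finTwoArrow]
  simp_rw [e2]
  rw [Measure.volume_eq_prod, lintegral_prod_mul hf.aemeasurable hg.aemeasurable]

namespace BoundaryChart

variable {Γ : Set E3} (C : BoundaryChart Γ)

/-- The orthogonal projection to the plane of the first two axes of the chart. -/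
noncomputable def planeProj (x : E3) : EuclideanSpace ℝ (Fin 2) := !₂[⟪C.b 0, x⟫, ⟪C.b 1, x⟫]

lemma lipschitzWith_planeProj : LipschitzWith 1 C.planeProj := by
  refine LipschitzWith.of_dist_le_mul fun x y => ?_
  rw [NNReal.coe_one, one_mul, dist_eq_norm, dist_eq_norm]
  refine le_of_sq_le_sq ?_ (norm_nonneg _)
  have h1 := norm_sq_frameVec C.b ⟪C.b 0, x - y⟫ ⟪C.b 1, x - y⟫ ⟪C.b 2, x - y⟫
  rw [frameVec_inner] at h1
  rw [h1, EuclideanSpace.real_norm_sq_eq, Fin.sum_univ_two]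
  simp only [planeProj, PiLp.sub_apply, inner_sub_right, Matrix.cons_val]
  nlinarith [sq_nonneg (⟪C.b 2, x⟫ - ⟪C.b 2, y⟫)]

/-- The polar coordinates `(ρ, t)` of the projected boundary cone: the point of the generator
through `γ(t)` at distance `ρ` from the origin is mapped to `(ρ / |γ(t)|) (1, t)`. -/
noncomputable def polarMap (v : Fin 2 → ℝ) : Fin 2 → ℝ :=
  ![v 0 * ‖C.curve (v 1)‖⁻¹, v 0 * ‖C.curve (v 1)‖⁻¹ * v 1]

lemma hasDerivAt_inv_norm_curve {t : ℝ} (ht : t ∈ Ioo (-C.δ) C.δ) :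
    HasDerivAt (fun s => ‖C.curve s‖⁻¹) (deriv (fun s => ‖C.curve s‖⁻¹) t) t :=
  (((C.hasDerivAt_curve ht).differentiableAt.norm ℝ (norm_pos_iff.1 (C.norm_curve_pos t))).inv
    (C.norm_curve_pos t).ne').hasDerivAt

lemma hasFDerivAt_polarMap {v : Fin 2 → ℝ} (hv : v 1 ∈ Ioo (-C.δ) C.δ) :
    HasFDerivAt C.polarMap (LinearMap.toContinuousLinearMap (Matrix.toLin'
      !![‖C.curve (v 1)‖⁻¹, v 0 * deriv (fun s => ‖C.curve s‖⁻¹) (v 1);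
        ‖C.curve (v 1)‖⁻¹ * v 1, v 0 * (deriv (fun s => ‖C.curve s‖⁻¹) (v 1) * v 1 +
          ‖C.curve (v 1)‖⁻¹)])) v := by
  rw [hasFDerivAt_pi']
  have p0 : HasFDerivAt (fun w : Fin 2 → ℝ => w 0) _ v := hasFDerivAt_apply (𝕜 := ℝ) 0 v
  have p1 : HasFDerivAt (fun w : Fin 2 → ℝ => w 1) _ v := hasFDerivAt_apply (𝕜 := ℝ) 1 v
  have q1 := (C.hasDerivAt_inv_norm_curve hv).comp_hasFDerivAt v p1
  intro i
  fin_cases i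
  · refine (p0.mul q1).congr_fderiv ?_
    ext w
    simp [dotProduct, Fin.sum_univ_two]
    ring
  · refine ((p0.mul q1).mul p1).congr_fderiv ?_
    ext w
    simp [dotProduct, Fin.sum_univ_two]
    ring

lemma injOn_polarMap : InjOn C.polarMap {v | 0 < v 0} := by
  intro v hv w hw h
  have hv : 0 < v 0 := hv
  have hw : 0 < w 0 := hw
  have h0 : v 0 * ‖C.curve (v 1)‖⁻¹ = w 0 * ‖C.curve (w 1)‖⁻¹ := congrFun h 0
  have h1 : v 0 * ‖C.curve (v 1)‖⁻¹ * v 1 = w 0 * ‖C.curve (w 1)‖⁻¹ * w 1 := congrFun h 1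
  have hp : 0 < w 0 * ‖C.curve (w 1)‖⁻¹ := mul_pos hw (inv_pos.2 (C.norm_curve_pos _))
  rw [h0] at h1
  have e1 : v 1 = w 1 := mul_left_cancel₀ hp.ne' h1
  rw [e1] at h0
  have e0 : v 0 = w 0 := mul_right_cancel₀ (inv_pos.2 (C.norm_curve_pos _)).ne' h0
  ext i
  fin_cases i
  · exact e0
  · exact e1

/-- The parameters at which the boundary curve lies in `B`. -/
def params (B : Set E3) : Set ℝ := {t | t ∈ Ioo (-C.δ) C.δ ∧ C.curve t ∈ B}

lemma params_subset (B : Set E3) : C.params B ⊆ Ioo (-C.δ) C.δ := fun _ h => h.1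

lemma measurableSet_params {B : Set E3} (hB : MeasurableSet B) : MeasurableSet (C.params B) := by
  have h1 : Continuous fun t : Ioo (-C.δ) C.δ => C.curve t :=
    continuousOn_iff_continuous_domRestrict.1 fun t ht =>
      (C.hasDerivAt_curve ht).continuousAt.continuousWithinAt
  have h2 := (MeasurableEmbedding.subtype_coe (measurableSet_Ioo (a := -C.δ) (b := C.δ))
    ).measurableSet_image.2 (h1.measurable hB)
  convert! h2 using 1
  ext t
  simp [params, and_comm]

lemma one_le_norm_curve (t : ℝ) : 1 ≤ ‖C.curve t‖ := by
  have := C.norm_curve_sq t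
  nlinarith [norm_nonneg (C.curve t), sq_nonneg t, sq_nonneg (C.u t)]

lemma norm_curve_le {t : ℝ} (ht : t ∈ Ioo (-C.δ) C.δ) : ‖C.curve t‖ ≤ 101 / 100 := by
  have h0 := C.norm_curve_sq t
  have h1 : t ^ 2 ≤ (1 / 100) ^ 2 :=
    sq_le_sq' (by linarith [ht.1, C.δ_le]) (by linarith [ht.2, C.δ_le])
  have h2 : C.u t ^ 2 ≤ (1 / 100) ^ 2 :=
    sq_le_sq' (by linarith [(abs_lt.1 (C.abs_u_lt t ht)).1, C.η_le])
      (by linarith [(abs_lt.1 (C.abs_u_lt t ht)).2, C.η_le])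
  refine le_of_sq_le_sq ?_ (by norm_num)
  nlinarith

lemma one_le_norm_normal (t : ℝ) : 1 ≤ ‖C.normal t‖ := by
  have := C.norm_normal_sq t
  nlinarith [norm_nonneg (C.normal t), sq_nonneg (t * deriv C.u t - C.u t), sq_nonneg (deriv C.u t)]

lemma norm_normal_le {t : ℝ} (ht : t ∈ Ioo (-C.δ) C.δ) : ‖C.normal t‖ ≤ 101 / 100 := by
  have h0 := C.norm_normal_sq t
  have h1 : |t| ≤ 1 / 100 := (abs_lt.2 ht).le.trans C.δ_le
  have h2 : |C.u t| ≤ 1 / 100 := (C.abs_u_lt t ht).le.trans C.η_le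
  have h3 := C.abs_deriv_le t ht
  have h4 : |t * deriv C.u t - C.u t| ≤ 11 / 1000 := by
    refine (abs_sub _ _).trans ?_
    rw [abs_mul]
    nlinarith [abs_nonneg t, abs_nonneg (deriv C.u t)]
  have h5 := sq_le_sq' (by linarith [(abs_le.1 h4).1]) (abs_le.1 h4).2
  have h6 := sq_le_sq' (by linarith [(abs_le.1 h3).1]) (abs_le.1 h3).2
  refine le_of_sq_le_sq ?_ (by norm_num)
  nlinarith

/-- The curvature integral of a radial weight over a conical piece of the boundary is bounded below
by the bend of the boundary curve. The area element is bounded below by that of the projection to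
the plane of the first two axes, which is nearly tangent to the boundary. -/
lemma bend_mul_le_lintegral (hsmooth : HasSmoothBoundaryOffOrigin Γ)
    (hH : ∀ p ∈ frontier Γ, p ≠ 0 → 0 ≤ meanCurvature Γ p) {B : Set E3} (hB : MeasurableSet B)
    (hBc : IsCone B) (hBb : B ⊆ C.box) {f : ℝ → ℝ} (hf : Measurable f) :
    (∫⁻ r in Ioi 0, ENNReal.ofReal (f r ^ 2)) * C.bend (C.params B) ≤ ENNReal.ofReal (105 / 100) *
      ∫⁻ x in frontier Γ ∩ B, ENNReal.ofReal (meanCurvature Γ x * f ‖x‖ ^ 2)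
        ∂(μHE[2] : Measure E3) := by
  set T := C.params B with hTdef
  have hT := C.measurableSet_params hB
  have hTs := C.params_subset B
  set S := frontier Γ ∩ B with hS
  set g : (Fin 2 → ℝ) → ℝ≥0∞ := fun w => ENNReal.ofReal
    (meanCurvature Γ (w 0 • C.curve (w 1 / w 0)) * f ‖w 0 • C.curve (w 1 / w 0)‖ ^ 2) with hg
  set D : Set (Fin 2 → ℝ) := {v | v 0 ∈ Ioi (0 : ℝ) ∧ v 1 ∈ T} with hD
  have hDm : MeasurableSet D := (measurableSet_Ioi.preimage (measurable_pi_apply 0)).inter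
    (hT.preimage (measurable_pi_apply 1))
  have hSm : MeasurableSet S := isClosed_frontier.measurableSet.inter hB
  have hπc : Continuous C.planeProj := C.lipschitzWith_planeProj.continuous
  -- the projection of the boundary piece dominates Lebesgue measure
  have hmeas : (volume : Measure (EuclideanSpace ℝ (Fin 2))).restrict (C.planeProj '' S) ≤
      (μHE[2].restrict S).map C.planeProj := by
    refine Measure.le_iff.2 fun E hE => ?_
    rw [Measure.restrict_apply hE, Measure.map_apply hπc.measurable hE,
      Measure.restrict_apply (hπc.measurable hE)]
    refine le_trans (measure_mono ?_)
      (volume_image_le_euclideanHausdorffMeasure C.lipschitzWith_planeProj _)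
    rintro _ ⟨hw, x, hx, rfl⟩
    exact ⟨x, ⟨hw, hx⟩, rfl⟩
  have step1 : ∫⁻ w in C.planeProj '' S, g w ≤
      ∫⁻ x in S, ENNReal.ofReal (meanCurvature Γ x * f ‖x‖ ^ 2) ∂(μHE[2] : Measure E3) := by
    refine (lintegral_mono' hmeas (le_refl fun w : EuclideanSpace ℝ (Fin 2) => g w)).trans ?_
    refine (lintegral_map_le _ _).trans_eq (setLIntegral_congr_fun hSm fun x hx => ?_)
    have := C.eq_smul_curve (hBb hx.2) hx.1
    simp only [hg, planeProj, Matrix.cons_val]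
    rw [← this]
  have step2 : ∫⁻ v in C.polarMap '' D, g v ≤ ∫⁻ w in C.planeProj '' S, g w := by
    have h1 := (PiLp.volume_preserving_ofLp (Fin 2)).setLIntegral_comp_emb
      (MeasurableEquiv.toLp 2 (Fin 2 → ℝ)).symm.measurableEmbedding g (C.planeProj '' S)
    rw [h1]
    refine lintegral_mono_set ?_
    rintro _ ⟨v, ⟨hv0, hv1⟩, rfl⟩
    have hr : 0 < v 0 * ‖C.curve (v 1)‖⁻¹ := mul_pos hv0 (inv_pos.2 (C.norm_curve_pos _))
    refine ⟨_, ⟨(v 0 * ‖C.curve (v 1)‖⁻¹) • C.curve (v 1),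
      ⟨C.smul_curve_mem_frontier hr (hTs hv1), hBc _ hv1.2 _ hr⟩, rfl⟩, ?_⟩
    ext i
    fin_cases i <;> simp [planeProj, polarMap, inner_smul_right, curve]
  have step3 : ∫⁻ v in C.polarMap '' D, g v = _ :=
    lintegral_image_eq_lintegral_abs_det_fderiv_mul volume hDm
      (fun v hv => (C.hasFDerivAt_polarMap (hTs hv.2)).hasFDerivWithinAt)
      (C.injOn_polarMap.mono fun v hv => hv.1) g
  have hmf : Measurable fun r => ENNReal.ofReal (f r ^ 2) := (hf.pow_const 2).ennreal_ofReal
  have hmu : Measurable (fun t => ENNReal.ofReal |deriv (deriv C.u) t|) :=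
    ((measurable_deriv _).abs).ennreal_ofReal
  have step4 : (∫⁻ r in Ioi 0, ENNReal.ofReal (f r ^ 2)) * C.bend T =
      ∫⁻ v in D, ENNReal.ofReal (f (v 0) ^ 2) * ENNReal.ofReal |deriv (deriv C.u) (v 1)| := by
    rw [bend, ← lintegral_indicator measurableSet_Ioi, ← lintegral_indicator hT,
      ← lintegral_fin_two_mul (hmf.indicator measurableSet_Ioi) (hmu.indicator hT),
      ← lintegral_indicator hDm]
    refine lintegral_congr fun v => ?_
    by_cases h0 : v 0 ∈ Ioi (0 : ℝ) <;> by_cases h1 : v 1 ∈ T <;> simp [hD, indicator, h0, h1]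
    all_goals simp_all
  rw [step4]
  refine le_trans ?_ (mul_le_mul_right (step2.trans step1) _)
  rw [step3, ← lintegral_const_mul' _ _ ENNReal.ofReal_ne_top]
  refine setLIntegral_mono' hDm fun v hv => ?_
  have hv0 : 0 < v 0 := hv.1
  have ht := hTs hv.2
  have hγ := C.norm_curve_pos (v 1)
  have hN := C.norm_normal_pos (v 1)
  have hr : 0 < v 0 * ‖C.curve (v 1)‖⁻¹ := mul_pos hv0 (inv_pos.2 hγ)
  have e1 : C.polarMap v 0 • C.curve (C.polarMap v 1 / C.polarMap v 0) =
      (v 0 * ‖C.curve (v 1)‖⁻¹) • C.curve (v 1) := by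
    simp only [polarMap, Matrix.cons_val]
    rw [mul_div_cancel_left₀ _ hr.ne']
  have e4 : v 0 * ‖C.curve (v 1)‖⁻¹ * ‖C.curve (v 1)‖ = v 0 := by
    rw [mul_assoc, inv_mul_cancel₀ hγ.ne', mul_one]
  simp only [hg, e1]
  rw [C.meanCurvature_eq hsmooth hr ht, norm_smul, Real.norm_of_nonneg hr.le, e4,
    LinearMap.det_toContinuousLinearMap, LinearMap.det_toLin',
    Matrix.det_fin_two, ← ENNReal.ofReal_mul (sq_nonneg _), ← ENNReal.ofReal_mul (abs_nonneg _),
    ← ENNReal.ofReal_mul (by norm_num)]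
  refine ENNReal.ofReal_le_ofReal ?_
  have hu := C.deriv_deriv_u_nonpos hsmooth hH ht
  rw [abs_of_nonpos hu]
  simp only [Matrix.of_apply, Matrix.cons_val', Matrix.cons_val]
  set k := -deriv (deriv C.u) (v 1) with hk
  have hk0 : 0 ≤ k := by linarith
  set γ := ‖C.curve (v 1)‖ with hγd
  set N := ‖C.normal (v 1)‖ with hNd
  have e2 : γ⁻¹ * (v 0 * (deriv (fun s => ‖C.curve s‖⁻¹) (v 1) * v 1 + γ⁻¹)) -
      v 0 * deriv (fun s => ‖C.curve s‖⁻¹) (v 1) * (γ⁻¹ * v 1) = v 0 * γ⁻¹ * γ⁻¹ := by ring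
  rw [e2, abs_of_pos (by positivity)]
  have e3 : 105 / 100 * (v 0 * γ⁻¹ * γ⁻¹ * (k * γ ^ 2 / (v 0 * γ⁻¹ * N ^ 3) * f (v 0) ^ 2)) =
      f (v 0) ^ 2 * k * (105 / 100 * γ / N ^ 3) := by
    field_simp
  rw [e3]
  refine le_mul_of_one_le_right (by positivity) ?_
  rw [le_div_iff₀ (by positivity), one_mul]
  have h1 : N ^ 3 ≤ (101 / 100) ^ 3 := pow_le_pow_left₀ hN.le (C.norm_normal_le ht) 3
  have h2 := C.one_le_norm_curve (v 1)
  nlinarith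

lemma norm_tangent_le {t : ℝ} (ht : t ∈ Ioo (-C.δ) C.δ) : ‖C.tangent t‖ ≤ 2 := by
  have h0 : ‖C.tangent t‖ ^ 2 = 1 + deriv C.u t ^ 2 := by
    rw [tangent, norm_sq_frameVec]; ring
  have h3 := C.abs_deriv_le t ht
  have h6 := sq_le_sq' (by linarith [(abs_le.1 h3).1]) (abs_le.1 h3).2
  refine le_of_sq_le_sq ?_ (by norm_num)
  nlinarith

/-- Bounded parts of the boundary inside a chart have finite area. -/
lemma measure_frontier_inter_lt_top (R : ℝ) :
    (μHE[2] : Measure E3) (frontier Γ ∩ C.box ∩ closedBall 0 R) < ⊤ := by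
  rcases lt_or_ge R 0 with hR | hR
  · simp [closedBall_eq_empty.2 hR]
  set Q : Set (ℝ × ℝ) := Icc 0 R ×ˢ Ioo (-C.δ) C.δ with hQ
  have hlip : LipschitzOnWith (⟨2 + 2 * R, by positivity⟩ : ℝ≥0)
      (fun p : ℝ × ℝ => p.1 • C.curve p.2) Q := by
    refine LipschitzOnWith.of_dist_le_mul ?_
    rintro ⟨r, t⟩ ⟨hr, ht⟩ ⟨r', t'⟩ ⟨hr', ht'⟩
    simp only at hr ht hr' ht'
    rw [dist_eq_norm, Prod.dist_eq]
    change _ ≤ (2 + 2 * R) * max (dist r r') (dist t t')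
    have h1 : ‖C.curve t - C.curve t'‖ ≤ 2 * ‖t - t'‖ :=
      Convex.norm_image_sub_le_of_norm_hasDerivWithin_le
        (fun s hs => (C.hasDerivAt_curve hs).hasDerivWithinAt) (fun s hs => C.norm_tangent_le hs)
        (convex_Ioo _ _) ht' ht
    have e : r • C.curve t - r' • C.curve t' =
        (r - r') • C.curve t + r' • (C.curve t - C.curve t') := by module
    rw [e]
    refine (norm_add_le _ _).trans ?_
    rw [norm_smul, norm_smul, Real.norm_of_nonneg hr'.1, Real.norm_eq_abs, ← Real.dist_eq]
    rw [← dist_eq_norm t t'] at h1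
    have h2 := C.norm_curve_le ht
    have h3 := le_max_left (dist r r') (dist t t')
    have h4 := le_max_right (dist r r') (dist t t')
    have h5 : dist r r' * ‖C.curve t‖ ≤ dist r r' * 2 :=
      mul_le_mul_of_nonneg_left (by linarith) dist_nonneg
    have h6 : r' * ‖C.curve t - C.curve t'‖ ≤ R * (2 * dist t t') :=
      mul_le_mul hr'.2 h1 (norm_nonneg _) hR
    have h7 : R * (2 * dist t t') ≤ R * (2 * max (dist r r') (dist t t')) :=
      mul_le_mul_of_nonneg_left (by linarith) hR
    linarith
  refine euclideanHausdorffMeasure_lt_top hlip ?_ ?_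
  · rw [Measure.volume_eq_prod, Measure.prod_prod, Real.volume_Icc, Real.volume_Ioo]
    exact ENNReal.mul_lt_top ENNReal.ofReal_lt_top ENNReal.ofReal_lt_top
  · rintro x ⟨⟨hxf, hxb⟩, hxR⟩
    refine ⟨(⟪C.b 0, x⟫, ⟪C.b 1, x⟫ / ⟪C.b 0, x⟫), ⟨⟨hxb.1.le, ?_⟩, C.mem_Ioo_of_mem_box hxb⟩,
      (C.eq_smul_curve hxb hxf).symm⟩
    rw [mem_closedBall_zero_iff] at hxR
    refine (real_inner_le_norm _ _).trans ?_
    rw [C.b.norm_eq_one, one_mul]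
    exact hxR

/-- The integrand of the curvature integral is integrable over the part of the boundary inside a
chart. -/
lemma integrableOn_meanCurvature_mul (hsmooth : HasSmoothBoundaryOffOrigin Γ)
    {F : E3 → ℝ} (hF : Continuous F) (hFc : HasCompactSupport F) (hF0 : (0 : E3) ∉ tsupport F) :
    IntegrableOn (fun x => meanCurvature Γ x * F x ^ 2) (frontier Γ ∩ C.box)
      (μHE[2] : Measure E3) := by
  obtain ⟨R, hR⟩ := hFc.isCompact.isBounded.subset_closedBall 0
  obtain ⟨a, ha, hab⟩ : ∃ a > 0, ball (0 : E3) a ⊆ (tsupport F)ᶜ :=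
    Metric.isOpen_iff.1 (isClosed_tsupport F).isOpen_compl 0 hF0
  obtain ⟨L, hL⟩ := hF.bounded_above_of_compact_support hFc
  set S := frontier Γ ∩ C.box with hS
  have hSm : MeasurableSet S := isClosed_frontier.measurableSet.inter C.isOpen_box.measurableSet
  -- on the boundary, the curvature agrees with a measurable function on the whole space
  set h : E3 → ℝ := fun x =>
    -deriv (deriv C.u) (⟪C.b 1, x⟫ / ⟪C.b 0, x⟫) * (‖x‖ / ⟪C.b 0, x⟫) ^ 2 / (⟪C.b 0, x⟫ *
      ‖frameVec C.b (⟪C.b 1, x⟫ / ⟪C.b 0, x⟫ * deriv C.u (⟪C.b 1, x⟫ / ⟪C.b 0, x⟫) -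
        ⟪C.b 2, x⟫ / ⟪C.b 0, x⟫) (-deriv C.u (⟪C.b 1, x⟫ / ⟪C.b 0, x⟫)) 1‖ ^ 3) with hh
  have hhm : Measurable h := by
    have m1 := measurable_deriv C.u
    have m2 := measurable_deriv (deriv C.u)
    have i0 : Measurable fun x : E3 => ⟪C.b 0, x⟫ := by fun_prop
    have i1 : Measurable fun x : E3 => ⟪C.b 1, x⟫ := by fun_prop
    have i2 : Measurable fun x : E3 => ⟪C.b 2, x⟫ := by fun_prop
    have j1 := i1.div i0
    have k1 := m1.comp j1
    have k2 := m2.comp j1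
    have v0 : Measurable fun x : E3 => frameVec C.b (⟪C.b 1, x⟫ / ⟪C.b 0, x⟫ *
        deriv C.u (⟪C.b 1, x⟫ / ⟪C.b 0, x⟫) - ⟪C.b 2, x⟫ / ⟪C.b 0, x⟫)
        (-deriv C.u (⟪C.b 1, x⟫ / ⟪C.b 0, x⟫)) 1 :=
      ((((j1.mul k1).sub (i2.div i0)).smul_const _).add (k1.neg.smul_const _)).add
        measurable_const
    exact (k2.neg.mul ((measurable_norm.div i0).pow_const 2)).div (i0.mul (v0.norm.pow_const 3))
  have hcurv : ∀ x ∈ S, meanCurvature Γ x = h x := by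
    rintro x ⟨hxf, hxb⟩
    have e := C.eq_smul_curve hxb hxf
    have hx0 := hxb.1
    have e2 := (C.mem_frontier_iff hxb).1 hxf
    have e3 : ⟪C.b 2, x⟫ / ⟪C.b 0, x⟫ = C.u (⟪C.b 1, x⟫ / ⟪C.b 0, x⟫) := by
      rw [e2, mul_div_cancel_left₀ _ hx0.ne']
    have e4 : ‖x‖ / ⟪C.b 0, x⟫ = ‖C.curve (⟪C.b 1, x⟫ / ⟪C.b 0, x⟫)‖ := by
      rw [div_eq_iff hx0.ne', mul_comm]
      conv_lhs => rw [e]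
      rw [norm_smul, Real.norm_of_nonneg hx0.le]
    simp only [hh, e3, e4]
    conv_lhs => rw [e]
    rw [C.meanCurvature_eq hsmooth hx0 (C.mem_Ioo_of_mem_box hxb)]
    rfl
  have hint : IntegrableOn (fun x => h x * F x ^ 2) (S ∩ closedBall 0 R)
      (μHE[2] : Measure E3) := by
    refine Measure.integrableOn_of_bounded (M := C.M * (101 / 100) ^ 3 / a * L ^ 2)
      (C.measure_frontier_inter_lt_top R).ne
      (hhm.mul (hF.measurable.pow_const 2)).aestronglyMeasurable ?_
    filter_upwards [ae_restrict_mem (hSm.inter isClosed_closedBall.measurableSet)] with x hx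
    have hM : 0 ≤ C.M :=
      (abs_nonneg _).trans (C.abs_deriv_deriv_le 0 ⟨by linarith [C.δ_pos], C.δ_pos⟩)
    by_cases hFx : F x = 0
    · rw [hFx]
      simp only [ne_eq, OfNat.ofNat_ne_zero, not_false_eq_true, zero_pow, mul_zero, norm_zero]
      positivity
    · obtain ⟨hxf, hxb⟩ := hx.1
      have hx0 := hxb.1
      have ht := C.mem_Ioo_of_mem_box hxb
      have hxa : a ≤ ‖x‖ := by
        by_contra hlt
        exact hab (mem_ball_zero_iff.2 (not_le.1 hlt)) (subset_tsupport F hFx)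
      have e := C.eq_smul_curve hxb hxf
      rw [← hcurv x hx.1]
      have en : ‖x‖ = ⟪C.b 0, x⟫ * ‖C.curve (⟪C.b 1, x⟫ / ⟪C.b 0, x⟫)‖ := by
        conv_lhs => rw [e]
        rw [norm_smul, Real.norm_of_nonneg hx0.le]
      set r := ⟪C.b 0, x⟫ with hr
      set t := ⟪C.b 1, x⟫ / r with htd
      have hHx : |meanCurvature Γ x| ≤ C.M * (101 / 100) ^ 3 / a := by
        have h0 : 0 < r * ‖C.normal t‖ ^ 3 := mul_pos hx0 (pow_pos (C.norm_normal_pos t) 3)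
        rw [e, C.meanCurvature_eq hsmooth hx0 ht, abs_div, abs_mul, abs_neg,
          abs_of_nonneg (sq_nonneg ‖C.curve t‖), abs_of_pos h0]
        have h1 := C.abs_deriv_deriv_le t ht
        have h2 := C.norm_curve_le ht
        have h3 := C.one_le_norm_normal t
        have h4 := C.norm_curve_pos t
        have h5 : a / (101 / 100) ≤ r := by
          rw [div_le_iff₀ (by norm_num)]
          have := mul_le_mul_of_nonneg_left h2 hx0.le
          linarith
        have h6 : a / (101 / 100) ≤ r * ‖C.normal t‖ ^ 3 :=
          h5.trans (le_mul_of_one_le_right hx0.le (one_le_pow₀ h3))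
        calc |deriv (deriv C.u) t| * ‖C.curve t‖ ^ 2 / (r * ‖C.normal t‖ ^ 3)
            ≤ C.M * (101 / 100) ^ 2 / (a / (101 / 100)) := by
              gcongr
          _ = C.M * (101 / 100) ^ 3 / a := by field_simp
      rw [norm_mul, norm_pow, Real.norm_eq_abs]
      exact mul_le_mul hHx (pow_le_pow_left₀ (norm_nonneg _) (hL x) 2) (by positivity)
        (by positivity)
  have hint2 : IntegrableOn (fun x => h x * F x ^ 2) S (μHE[2] : Measure E3) := by
    refine hint.of_forall_sdiff_eq_zero hSm fun x hx => ?_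
    have : F x = 0 := by
      by_contra hne
      exact hx.2 ⟨hx.1, hR (subset_tsupport F hne)⟩
    rw [this]; simp
  exact hint2.congr_fun (fun x hx => by rw [hcurv x hx]) hSm

end BoundaryChart

/-! ### Radial test functions -/

lemma setLIntegral_Icc_inv {a b : ℝ} (ha : 0 < a) (hab : a ≤ b) :
    ∫⁻ r in Icc a b, ENNReal.ofReal r⁻¹ = ENNReal.ofReal (Real.log (b / a)) := by
  have h0 : ∀ r ∈ Icc a b, 0 < r := fun r hr => ha.trans_le hr.1
  have hi : IntegrableOn (fun r : ℝ => r⁻¹) (Icc a b) :=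
    (continuousOn_inv₀.mono fun r hr => (h0 r hr).ne').integrableOn_Icc
  rw [← ofReal_integral_eq_lintegral_ofReal hi, integral_Icc_eq_integral_Ioc,
    ← intervalIntegral.integral_of_le hab, integral_inv_of_pos ha (ha.trans_le hab)]
  filter_upwards [ae_restrict_mem measurableSet_Icc] with r hr
  exact (inv_pos.2 (h0 r hr)).le

/-- Almost optimal test functions for Hardy's inequality `∫ f ^ 2 ≤ 4 ∫ (r f') ^ 2` on the half
line. They are `r ^ (-1/2)` times a cutoff that varies slowly in the variable `log r`, so that the
quotient comes close to `1 / 4`. -/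
lemma exists_hardy_test_function : ∃ f : ℝ → ℝ, ContDiff ℝ ∞ f ∧
    (∃ M, ∀ r, f r ≠ 0 → 1 ≤ |r| ∧ |r| ≤ M) ∧
    ∫⁻ r in Ioi 0, ENNReal.ofReal (f r ^ 2) ≠ 0 ∧
    ∫⁻ r in Ioi 0, ENNReal.ofReal (f r ^ 2) ≠ ⊤ ∧
    ∫⁻ r in Ioi 0, ENNReal.ofReal (r ^ 2 * deriv f r ^ 2) ≤
      ENNReal.ofReal (3 / 10) * ∫⁻ r in Ioi 0, ENNReal.ofReal (f r ^ 2) := by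
  let φ : ContDiffBump (0 : ℝ) := ⟨1, 2, by norm_num, by norm_num⟩
  have hφs : ContDiff ℝ ∞ φ := φ.contDiff
  have hφd : ∀ s, HasDerivAt φ (deriv φ s) s := fun s =>
    (hφs.differentiable (by simp) s).hasDerivAt
  have hφc : Continuous (deriv φ) := hφs.continuous_deriv (by simp)
  obtain ⟨L, hL⟩ := hφc.bounded_above_of_compact_support φ.hasCompactSupport.deriv
  have hL0 : 0 ≤ L := (norm_nonneg _).trans (hL 0)
  have hφ0 : ∀ s, φ s ≠ 0 → |s| < 2 := fun s hs => by
    have : s ∈ Function.support φ := hs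
    rw [φ.support_eq] at this
    simpa [Real.dist_eq] using this
  have hφ'0 : ∀ s, deriv φ s ≠ 0 → |s| ≤ 2 := fun s hs => by
    have := support_deriv_subset hs
    rw [φ.tsupport_eq] at this
    simpa [Real.dist_eq] using this
  set R := 30 * (L + 1) with hR
  have hR0 : 0 < R := by positivity
  set f : ℝ → ℝ := fun r => Real.exp (-Real.log r / 2) * φ (Real.log r / R - 3) with hf
  have hlog : ∀ r, |Real.log r / R - 3| ≤ 2 → R ≤ Real.log r ∧ Real.log r ≤ 5 * R := fun r hr => by
    have := abs_le.1 hr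
    constructor
    · have := (le_div_iff₀ hR0).1 (show 1 ≤ Real.log r / R by linarith)
      linarith
    · have := (div_le_iff₀ hR0).1 (show Real.log r / R ≤ 5 by linarith)
      linarith
  have hsupp : ∀ r, f r ≠ 0 → 1 ≤ |r| ∧ |r| ≤ Real.exp (5 * R) := fun r hr => by
    obtain ⟨h1, h2⟩ := hlog r (hφ0 _ (right_ne_zero_of_mul hr)).le
    have hr0 : r ≠ 0 := by
      rintro rfl
      rw [Real.log_zero] at h1
      linarith
    rw [← Real.log_abs] at h1 h2
    have hp := abs_pos.2 hr0
    exact ⟨((Real.log_pos_iff hp.le).1 (by linarith)).le, (Real.log_le_iff_le_exp hp).1 h2⟩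
  have hmem : ∀ r, 0 < r → |Real.log r / R - 3| ≤ 2 →
      r ∈ Icc (Real.exp R) (Real.exp (5 * R)) := fun r hr h => by
    obtain ⟨h1, h2⟩ := hlog r h
    exact ⟨(Real.le_log_iff_exp_le hr).1 h1, (Real.log_le_iff_le_exp hr).1 h2⟩
  have hexp : ∀ r, 0 < r → Real.exp (-Real.log r / 2) ^ 2 = r⁻¹ := fun r hr => by
    rw [← Real.exp_nat_mul, Nat.cast_ofNat, mul_div_cancel₀ _ two_ne_zero, Real.exp_neg,
      Real.exp_log hr]
  have hfsq : ∀ r, 0 < r → f r ^ 2 = r⁻¹ * φ (Real.log r / R - 3) ^ 2 := fun r hr => by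
    rw [hf]
    simp only [mul_pow, hexp r hr]
  have hsmooth : ContDiff ℝ ∞ f := by
    refine contDiff_iff_contDiffAt.2 fun r => ?_
    rcases eq_or_ne r 0 with rfl | hr
    · have : f =ᶠ[𝓝 0] fun _ => 0 := by
        filter_upwards [ball_mem_nhds (0 : ℝ) one_pos] with s hs
        by_contra h
        rw [mem_ball_zero_iff, Real.norm_eq_abs] at hs
        exact absurd (hsupp s h).1 (not_le.2 hs)
      exact contDiffAt_const.congr_of_eventuallyEq this
    · have hl : ContDiffAt ℝ ∞ Real.log r := Real.contDiffAt_log.2 hr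
      exact (Real.contDiff_exp.contDiffAt.comp r (hl.neg.div_const 2)).mul
        (hφs.contDiffAt.comp r ((hl.div_const R).sub contDiffAt_const))
  have hderiv : ∀ r, 0 < r → r ^ 2 * deriv f r ^ 2 =
      r⁻¹ * (deriv φ (Real.log r / R - 3) / R - φ (Real.log r / R - 3) / 2) ^ 2 := fun r hr => by
    have hl := Real.hasDerivAt_log hr.ne'
    have h0 : HasDerivAt (fun s => φ (Real.log s / R - 3))
        (deriv φ (Real.log r / R - 3) * (r⁻¹ / R)) r :=
      HasDerivAt.comp (h₂ := φ) (h := fun s => Real.log s / R - 3) r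
        (hφd (Real.log r / R - 3)) ((hl.div_const R).sub_const 3)
    have h1 : HasDerivAt f _ r := ((hl.neg.div_const 2).exp).mul h0
    rw [h1.deriv]
    conv_rhs => rw [← hexp r hr]
    simp only [Pi.neg_apply]
    generalize Real.exp (-Real.log r / 2) = E
    generalize φ (Real.log r / R - 3) = a
    generalize deriv φ (Real.log r / R - 3) = b
    field_simp
    ring
  set J := ∫⁻ r in Ioi 0, ENNReal.ofReal (f r ^ 2) with hJ
  have hI : ∀ k l : ℝ, k ≤ l → ∫⁻ r in Icc (Real.exp (k * R)) (Real.exp (l * R)),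
      ENNReal.ofReal r⁻¹ = ENNReal.ofReal ((l - k) * R) := fun k l hkl => by
    rw [setLIntegral_Icc_inv (Real.exp_pos _)
      (Real.exp_le_exp.2 (mul_le_mul_of_nonneg_right hkl hR0.le)), ← Real.exp_sub, Real.log_exp,
      sub_mul]
  have hsub : ∀ k l : ℝ, Icc (Real.exp (k * R)) (Real.exp (l * R)) ⊆ Ioi 0 := fun k l r hr =>
    (Real.exp_pos _).trans_le hr.1
  have hlow : ENNReal.ofReal ((4 - 2) * R) ≤ J := by
    rw [← hI 2 4 (by norm_num)]
    refine le_trans (le_of_eq ?_) (lintegral_mono_set (hsub 2 4))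
    refine setLIntegral_congr_fun measurableSet_Icc fun r hr => ?_
    have hr0 : 0 < r := hsub _ _ hr
    have hone : φ (Real.log r / R - 3) = 1 := by
      refine φ.one_of_mem_closedBall ?_
      rw [mem_closedBall, Real.dist_eq, sub_zero, abs_le]
      have h1 := (Real.le_log_iff_exp_le hr0).2 hr.1
      have h2 := (Real.log_le_iff_le_exp hr0).2 hr.2
      have h3 := (le_div_iff₀ hR0).2 h1
      have h4 := (div_le_iff₀ hR0).2 h2
      exact ⟨by change -1 ≤ _; linarith, by change _ ≤ (1 : ℝ); linarith⟩
    simp only [hfsq r hr0, hone, one_pow, mul_one]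
  have hbound : ∀ (g : ℝ → ℝ) (A : ℝ), 0 ≤ A → (∀ r, 0 < r → r ∉ Icc (Real.exp (1 * R))
      (Real.exp (5 * R)) → g r = 0) → (∀ r, 0 < r → g r ≤ A * r⁻¹) →
      ∫⁻ r in Ioi 0, ENNReal.ofReal (g r) ≤ ENNReal.ofReal (A * ((5 - 1) * R)) := by
    intro g A hA h0 h1
    rw [ENNReal.ofReal_mul hA, ← hI 1 5 (by norm_num), ← lintegral_const_mul' _ _ ENNReal.ofReal_ne_top,
      ← lintegral_indicator measurableSet_Icc]
    refine (setLIntegral_mono' measurableSet_Ioi fun r hr => ?_).trans (setLIntegral_le_lintegral _ _)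
    by_cases hm : r ∈ Icc (Real.exp (1 * R)) (Real.exp (5 * R))
    · rw [indicator_of_mem hm, ← ENNReal.ofReal_mul hA]
      exact ENNReal.ofReal_le_ofReal (h1 r hr)
    · rw [h0 r hr hm, ENNReal.ofReal_zero]
      exact zero_le
  have hle1 : ∀ s, φ s ^ 2 ≤ 1 := fun s => pow_le_one₀ φ.nonneg φ.le_one
  have hup : J ≤ ENNReal.ofReal (1 * ((5 - 1) * R)) := by
    refine hbound _ 1 zero_le_one (fun r hr hm => ?_) fun r hr => ?_
    · by_contra h
      rw [one_mul] at hm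
      refine hm (hmem r hr (hφ0 _ fun h' => h ?_).le)
      rw [hfsq r hr, h']
      simp
    · rw [hfsq r hr, one_mul]
      exact mul_le_of_le_one_right (inv_pos.2 hr).le (hle1 _)
  refine ⟨f, hsmooth, ⟨_, hsupp⟩, ?_, ?_, ?_⟩
  · refine fun h => absurd (hlow.trans_eq h) (not_le.2 ?_)
    rw [ENNReal.ofReal_pos]
    linarith
  · exact ne_top_of_le_ne_top ENNReal.ofReal_ne_top hup
  have hcut : ∫⁻ r in Ioi 0,
      ENNReal.ofReal (11 * (r⁻¹ * (deriv φ (Real.log r / R - 3) / R) ^ 2)) ≤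
      ENNReal.ofReal (25 / 1000) * J := by
    refine (hbound _ (11 * (L / R) ^ 2) (by positivity) (fun r hr hm => ?_) fun r hr => ?_).trans ?_
    · by_contra h
      rw [one_mul] at hm
      refine hm (hmem r hr (hφ'0 _ fun h' => h ?_))
      rw [h']
      simp
    · have h1 : (deriv φ (Real.log r / R - 3) / R) ^ 2 ≤ (L / R) ^ 2 := by
        rw [div_pow, div_pow, ← sq_abs (deriv φ _)]
        have := hL (Real.log r / R - 3)
        rw [Real.norm_eq_abs] at this
        gcongr
      have h2 := mul_le_mul_of_nonneg_left h1 (inv_pos.2 hr).le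
      linarith
    · refine le_trans ?_ (mul_le_mul_right hlow _)
      rw [← ENNReal.ofReal_mul (by norm_num)]
      refine ENNReal.ofReal_le_ofReal ?_
      have e : 11 * (L / R) ^ 2 * ((5 - 1) * R) = 44 * L ^ 2 / R := by
        field_simp
        ring
      rw [e, div_le_iff₀ hR0, hR]
      nlinarith
  calc ∫⁻ r in Ioi 0, ENNReal.ofReal (r ^ 2 * deriv f r ^ 2)
      ≤ ∫⁻ r in Ioi 0, (ENNReal.ofReal (275 / 1000) * ENNReal.ofReal (f r ^ 2) +
        ENNReal.ofReal (11 * (r⁻¹ * (deriv φ (Real.log r / R - 3) / R) ^ 2))) := by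
        refine setLIntegral_mono' measurableSet_Ioi fun r hr => ?_
        have hr : 0 < r := hr
        have hi := inv_pos.2 hr
        rw [← ENNReal.ofReal_mul (by norm_num), ← ENNReal.ofReal_add (by positivity)
          (by positivity)]
        refine ENNReal.ofReal_le_ofReal ?_
        rw [hderiv r hr, hfsq r hr]
        have h1 : ∀ a b : ℝ, (a - b / 2) ^ 2 ≤ 275 / 1000 * b ^ 2 + 11 * a ^ 2 := fun a b => by
          nlinarith [sq_nonneg (10 * a + b / 2)]
        have := mul_le_mul_of_nonneg_left (h1 (deriv φ (Real.log r / R - 3) / R)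
          (φ (Real.log r / R - 3))) hi.le
        linarith
    _ ≤ ENNReal.ofReal (275 / 1000) * J + ENNReal.ofReal (25 / 1000) * J := by
        rw [lintegral_add_left ((hsmooth.continuous.measurable.pow_const 2).ennreal_ofReal.const_mul
          _), lintegral_const_mul' _ _ ENNReal.ofReal_ne_top]
        gcongr
    _ = ENNReal.ofReal (3 / 10) * J := by
        rw [← add_mul, ← ENNReal.ofReal_add (by norm_num) (by norm_num)]
        norm_num

lemma isTestFunctionOffOrigin_radial {f : ℝ → ℝ} (hf : ContDiff ℝ ∞ f)
    (hM : ∃ M, ∀ r, f r ≠ 0 → 1 ≤ |r| ∧ |r| ≤ M) :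
    IsTestFunctionOffOrigin fun x => f ‖x‖ := by
  obtain ⟨M, hM⟩ := hM
  have h0 : (fun x : E3 => f ‖x‖) =ᶠ[𝓝 0] 0 := by
    filter_upwards [ball_mem_nhds (0 : E3) one_pos] with x hx
    by_contra h
    rw [mem_ball_zero_iff] at hx
    have := (hM _ h).1
    rw [abs_norm] at this
    exact absurd this (not_le.2 hx)
  refine ⟨contDiff_iff_contDiffAt.2 fun x => ?_, ?_, notMem_tsupport_iff_eventuallyEq.2 h0⟩
  · rcases eq_or_ne x 0 with rfl | hx
    · exact (contDiffAt_const (c := (0 : ℝ))).congr_of_eventuallyEq h0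
    · exact hf.contDiffAt.comp x (contDiffAt_norm (E := E3) ℝ hx)
  · refine HasCompactSupport.intro (isCompact_closedBall (0 : E3) M) fun x hx => ?_
    by_contra h
    have := (hM _ h).2
    rw [abs_norm] at this
    exact hx (mem_closedBall_zero_iff.2 this)

/-- The cone metric has length factor `√(1 + c ^ 2)` in the radial direction. -/
lemma sum_coneInvMetric_radial (c : ℝ) {f : ℝ → ℝ} (hf : Differentiable ℝ f) {x : E3}
    (hx : x ≠ 0) :
    ∑ i : Fin 3, ∑ j : Fin 3, coneInvMetric c x i j * partialDeriv i (fun y => f ‖y‖) x *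
      partialDeriv j (fun y => f ‖y‖) x = deriv f ‖x‖ ^ 2 / (1 + c ^ 2) := by
  have hn : 0 < ‖x‖ := norm_pos_iff.2 hx
  have hp : ∀ i, partialDeriv i (fun y => f ‖y‖) x = deriv f ‖x‖ * (x i / ‖x‖) := fun i => by
    have h1 : HasFDerivAt (fun y : E3 => ‖y‖ ^ 2) (2 • innerSL ℝ x) x :=
      (hasStrictFDerivAt_norm_sq x).hasFDerivAt
    have h2 : HasFDerivAt (fun y : E3 => ‖y‖) ((1 / (2 * ‖x‖)) • 2 • innerSL ℝ x) x := by
      simpa only [Real.sqrt_sq (norm_nonneg _)] using h1.sqrt (by positivity)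
    have h3 := (hf ‖x‖).hasDerivAt.comp_hasFDerivAt x h2
    have h4 : fderiv ℝ (fun y : E3 => f ‖y‖) x = _ := h3.fderiv
    rw [partialDeriv, h4]
    simp only [smul_apply, innerSL_apply_apply, EuclideanSpace.inner_single_right,
      smul_eq_mul, nsmul_eq_mul, Nat.cast_ofNat, conj_trivial, one_mul]
    field_simp
  have hsq : ‖x‖ ^ 2 = x 0 ^ 2 + x 1 ^ 2 + x 2 ^ 2 := by
    rw [EuclideanSpace.real_norm_sq_eq, Fin.sum_univ_three]
  have hc : 0 < 1 + c ^ 2 := by positivity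
  simp only [hp, Fin.sum_univ_three, coneInvMetric, Matrix.of_apply]
  simp only [Fin.isValue, if_true, Fin.reduceEq, if_false, mul_one, mul_zero, zero_sub]
  generalize ‖x‖ = n at *
  generalize deriv f n = d
  field_simp
  rw [show n ^ 4 = (n ^ 2) ^ 2 by ring]
  rw [hsq]
  ring

/-- Polar coordinates on a cone. -/
lemma IsCone.setLIntegral_norm_le {S : Set E3} (hS : IsCone S) (hSm : MeasurableSet S)
    {g : ℝ → ℝ≥0∞} (hg : Measurable g) :
    ∫⁻ x in S, g ‖x‖ ≤
      3 * volume (S ∩ ball 0 1) * ∫⁻ r in Ioi 0, ENNReal.ofReal (r ^ 2) * g r := by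
  set s : Set (sphere (0 : E3) 1) := Subtype.val ⁻¹' S with hs
  have hsm : MeasurableSet s := measurable_subtype_coe hSm
  have hdim : Module.finrank ℝ E3 = 3 := by simp
  have hms : (volume : Measure E3).toSphere s ≤ 3 * volume (S ∩ ball 0 1) := by
    rw [Measure.toSphere_apply' _ hsm, hdim]
    push_cast
    refine mul_le_mul_right (measure_mono ?_) _
    rintro _ ⟨t, ht, _, ⟨y, hy, rfl⟩, rfl⟩
    refine ⟨hS _ hy t ht.1, ?_⟩
    have hy1 : ‖(y : E3)‖ = 1 := by simp
    simp only [mem_ball_zero_iff, norm_smul, hy1, mul_one, Real.norm_of_nonneg ht.1.le]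
    exact ht.2
  have hmem : ∀ x : E3, x ≠ 0 → (x ∈ S ↔ ‖x‖⁻¹ • x ∈ S) := fun x hx =>
    (hS.smul_mem_iff (inv_pos.2 (norm_pos_iff.2 hx))).symm
  calc ∫⁻ x in S, g ‖x‖ = ∫⁻ x, S.indicator (fun x => g ‖x‖) x := by
        rw [lintegral_indicator hSm]
    _ = ∫⁻ x : ({(0)}ᶜ : Set E3), S.indicator (fun x => g ‖x‖) x
          ∂((volume : Measure E3).comap (↑)) := by
        rw [lintegral_subtype_comap (measurableSet_singleton _).compl,
          restrict_compl_singleton]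
    _ = ∫⁻ p : sphere (0 : E3) 1 × Ioi (0 : ℝ), s.indicator 1 p.1 * g p.2
          ∂((volume : Measure E3).toSphere.prod (.volumeIoiPow (Module.finrank ℝ E3 - 1))) := by
        rw [← (volume : Measure E3).measurePreserving_homeomorphUnitSphereProd.lintegral_comp_emb
          (Homeomorph.measurableEmbedding _)]
        refine lintegral_congr fun x => ?_
        have hx : (x : E3) ≠ 0 := x.2
        by_cases hxS : (x : E3) ∈ S
        · have := (hmem x hx).1 hxS
          rw [indicator_of_mem hxS, indicator_of_mem (by simpa [hs] using this)]
          simp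
        · have := mt (hmem x hx).2 hxS
          rw [indicator_of_notMem hxS, indicator_of_notMem (by simpa [hs] using this)]
          simp
    _ = (volume : Measure E3).toSphere s * ∫⁻ r : Ioi (0 : ℝ), g r ∂.volumeIoiPow 2 := by
        rw [← lintegral_indicator_one hsm, hdim]
        exact lintegral_prod_mul (measurable_one.indicator hsm).aemeasurable
          (hg.comp measurable_subtype_coe).aemeasurable
    _ = (volume : Measure E3).toSphere s * ∫⁻ r in Ioi 0, ENNReal.ofReal (r ^ 2) * g r := by
        congr 1
        refine (lintegral_withDensity_eq_lintegral_mul _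
          ((measurable_subtype_coe.pow_const 2).ennreal_ofReal)
          (hg.comp measurable_subtype_coe)).trans ?_
        exact lintegral_subtype_comap measurableSet_Ioi fun r => ENNReal.ofReal (r ^ 2) * g r
    _ ≤ _ := mul_le_mul_left hms _

/-- The right-hand side of the stability inequality for a radial test function. -/
lemma ofReal_integral_radial_le (c : ℝ) {Γ : Set E3} (hopen : IsOpen Γ) (hcone : IsCone Γ)
    (h0 : (0 : E3) ∉ Γ) {f : ℝ → ℝ} (hf : ContDiff ℝ ∞ f) :
    ENNReal.ofReal (∫ x in Γ, ∑ i : Fin 3, ∑ j : Fin 3, coneInvMetric c x i j *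
      partialDeriv i (fun y => f ‖y‖) x * partialDeriv j (fun y => f ‖y‖) x) ≤
      3 * volume (Γ ∩ ball 0 1) * ∫⁻ r in Ioi 0, ENNReal.ofReal (r ^ 2 * deriv f r ^ 2) := by
  have hd : Differentiable ℝ f := hf.differentiable (by simp)
  have hdm : Measurable fun r => deriv f r ^ 2 := (measurable_deriv f).pow_const 2
  have hc : 1 ≤ 1 + c ^ 2 := by nlinarith
  have hm : Measurable fun x : E3 => deriv f ‖x‖ ^ 2 / (1 + c ^ 2) :=
    (hdm.comp measurable_norm).div_const _
  rw [setIntegral_congr_fun hopen.measurableSet fun x hx =>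
    sum_coneInvMetric_radial c hd (show x ≠ 0 from fun h => h0 (h ▸ hx)),
    integral_eq_lintegral_of_nonneg_ae (ae_of_all _ fun x => by positivity)
      hm.aestronglyMeasurable]
  refine ENNReal.ofReal_toReal_le.trans ?_
  refine (lintegral_mono fun x => ENNReal.ofReal_le_ofReal
    (div_le_self (sq_nonneg (deriv f ‖x‖)) hc)).trans ?_
  refine (hcone.setLIntegral_norm_le hopen.measurableSet hdm.ennreal_ofReal).trans_eq ?_
  congr 1
  refine lintegral_congr fun r => ?_
  rw [ENNReal.ofReal_mul (sq_nonneg r)]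

/-! ### Connectedness of the interior of the complement -/

section Connectedness

variable {Γ : Set E3}

/-- The boundary is covered by finitely many disjoint conical pieces, each inside a chart. -/
lemma exists_conical_partition (hcone : IsCone Γ) (hsmooth : HasSmoothBoundaryOffOrigin Γ) :
    ∃ (n : ℕ) (C : Fin n → BoundaryChart Γ) (B : Fin n → Set E3),
      (∀ i, MeasurableSet (B i)) ∧ (∀ i, IsCone (B i)) ∧ (∀ i, B i ⊆ (C i).box) ∧
      Pairwise (Function.onFun Disjoint B) ∧ ∀ p ∈ frontier Γ, p ≠ 0 → ∃ i, p ∈ B i := by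
  have hcpt : IsCompact (frontier Γ ∩ sphere 0 1) :=
    (isCompact_sphere (0 : E3) 1).inter_left isClosed_frontier
  obtain ⟨t, ht⟩ := hcpt.elim_finite_subcover (fun C : BoundaryChart Γ => C.box)
    (fun C => C.isOpen_box) (fun p hp => by
      obtain ⟨C, hC⟩ := exists_boundaryChart_mem_box hcone hsmooth hp.1
        (ne_zero_of_mem_unit_sphere ⟨p, hp.2⟩)
      exact mem_iUnion.2 ⟨C, hC⟩)
  let C : Fin t.card → BoundaryChart Γ := fun i => t.equivFin.symm i
  have hcover : ∀ p ∈ frontier Γ, p ≠ 0 → ∃ i, p ∈ (C i).box := fun p hp hp0 => by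
    have hn : 0 < ‖p‖⁻¹ := inv_pos.2 (norm_pos_iff.2 hp0)
    obtain ⟨D, hD, hpD⟩ := mem_iUnion₂.1 (ht ⟨hcone.frontier p hp _ hn, by
      simp [norm_smul, hp0]⟩)
    refine ⟨t.equivFin ⟨D, hD⟩, ?_⟩
    simp only [C, Equiv.symm_apply_apply]
    exact (D.isCone_box.smul_mem_iff hn).1 hpD
  refine ⟨t.card, C, fun i => (C i).box \ ⋃ j, ⋃ (_ : j < i), (C j).box, fun i => ?_, fun i => ?_,
    fun i => sdiff_subset, ?_, fun p hp hp0 => ?_⟩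
  · exact (C i).isOpen_box.measurableSet.diff
      (isOpen_iUnion fun j => isOpen_iUnion fun _ => (C j).isOpen_box).measurableSet
  · rintro x ⟨hx, hx'⟩ r hr
    refine ⟨(C i).isCone_box x hx r hr, fun h => hx' ?_⟩
    simp only [mem_iUnion] at h ⊢
    obtain ⟨j, hj, h⟩ := h
    exact ⟨j, hj, ((C j).isCone_box.smul_mem_iff hr).1 h⟩
  · have key : ∀ i j, i < j → Disjoint ((C i).box \ ⋃ k, ⋃ (_ : k < i), (C k).box)
        ((C j).box \ ⋃ k, ⋃ (_ : k < j), (C k).box) := fun i j hij =>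
      Set.disjoint_left.2 fun x hx hx' => hx'.2 (mem_iUnion₂.2 ⟨i, hij, hx.1⟩)
    intro i j hij
    rcases lt_or_gt_of_ne hij with h | h
    · exact key i j h
    · exact (key j i h).symm
  · obtain ⟨i, hi, hmin⟩ := wellFounded_lt.has_min {i | p ∈ (C i).box} (hcover p hp hp0)
    refine ⟨i, hi, fun h => ?_⟩
    obtain ⟨j, hj, h⟩ := mem_iUnion₂.1 h
    exact hmin j h hj

lemma integrableOn_frontier (hcone : IsCone Γ) (hsmooth : HasSmoothBoundaryOffOrigin Γ)
    {F : E3 → ℝ} (hF : IsTestFunctionOffOrigin F) :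
    IntegrableOn (fun x => meanCurvature Γ x * F x ^ 2) (frontier Γ) (μHE[2] : Measure E3) := by
  obtain ⟨n, C, B, -, -, hBb, -, hcover⟩ := exists_conical_partition hcone hsmooth
  have h1 : IntegrableOn (fun x => meanCurvature Γ x * F x ^ 2)
      (⋃ i, frontier Γ ∩ (C i).box) (μHE[2] : Measure E3) :=
    integrableOn_finite_iUnion.2 fun i =>
      (C i).integrableOn_meanCurvature_mul hsmooth hF.1.continuous hF.2.1 hF.2.2
  refine h1.of_forall_sdiff_eq_zero isClosed_frontier.measurableSet fun x hx => ?_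
  rcases eq_or_ne x 0 with rfl | hx0
  · rw [image_eq_zero_of_notMem_tsupport hF.2.2]
    simp
  · obtain ⟨i, hi⟩ := hcover x hx.1 hx0
    exact (hx.2 (mem_iUnion.2 ⟨i, ⟨hx.1, hBb i hi⟩⟩)).elim

/-- The stability inequality, tested with almost optimal functions for Hardy's inequality, bounds
the total bend of the boundary. -/
lemma sum_bend_le (hopen : IsOpen Γ) (hcone : IsCone Γ) (h0 : (0 : E3) ∉ Γ)
    (hsmooth : HasSmoothBoundaryOffOrigin Γ)
    (hH : ∀ p ∈ frontier Γ, p ≠ 0 → 0 ≤ meanCurvature Γ p) {c : ℝ}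
    (hstab : SatisfiesStabilityInequality c Γ) {n : ℕ} {C : Fin n → BoundaryChart Γ}
    {B : Fin n → Set E3} (hBm : ∀ i, MeasurableSet (B i)) (hBc : ∀ i, IsCone (B i))
    (hBb : ∀ i, B i ⊆ (C i).box) (hBd : Pairwise (Function.onFun Disjoint B)) :
    ∑ i, (C i).bend ((C i).params (B i)) ≤
      ENNReal.ofReal (945 / 1000) * volume (Γ ∩ ball 0 1) := by
  obtain ⟨f, hf, hfM, hJ0, hJt, hder⟩ := exists_hardy_test_function
  set J := ∫⁻ r in Ioi 0, ENNReal.ofReal (f r ^ 2) with hJ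
  have hF := isTestFunctionOffOrigin_radial hf hfM
  have hfr : MeasurableSet (frontier Γ) := isClosed_frontier.measurableSet
  have hnonneg : ∀ x ∈ frontier Γ, 0 ≤ meanCurvature Γ x * f ‖x‖ ^ 2 := fun x hx => by
    rcases eq_or_ne x 0 with rfl | hx0
    · have : f ‖(0 : E3)‖ = 0 := image_eq_zero_of_notMem_tsupport (f := fun x : E3 => f ‖x‖) hF.2.2
      rw [this]
      simp
    · exact mul_nonneg (hH x hx hx0) (sq_nonneg _)
  have h1 : ∫⁻ x in frontier Γ, ENNReal.ofReal (meanCurvature Γ x * f ‖x‖ ^ 2)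
      ∂(μHE[2] : Measure E3) ≤
      3 * volume (Γ ∩ ball 0 1) * (ENNReal.ofReal (3 / 10) * J) := by
    rw [← ofReal_integral_eq_lintegral_ofReal (integrableOn_frontier hcone hsmooth hF)
      ((ae_restrict_mem hfr).mono hnonneg)]
    refine (ENNReal.ofReal_le_ofReal (hstab _ hF)).trans ?_
    exact (ofReal_integral_radial_le c hopen hcone h0 hf).trans (mul_le_mul_right hder _)
  have h2 : ∑ i, ∫⁻ x in frontier Γ ∩ B i, ENNReal.ofReal (meanCurvature Γ x * f ‖x‖ ^ 2)
      ∂(μHE[2] : Measure E3) ≤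
      ∫⁻ x in frontier Γ, ENNReal.ofReal (meanCurvature Γ x * f ‖x‖ ^ 2)
        ∂(μHE[2] : Measure E3) := by
    rw [← tsum_fintype (L := .unconditional _), ← lintegral_iUnion (fun i => hfr.inter (hBm i))
      (fun i j hij => (hBd hij).mono inter_subset_right inter_subset_right)]
    exact lintegral_mono_set (iUnion_subset fun i => inter_subset_left)
  have h3 : J * ∑ i, (C i).bend ((C i).params (B i)) ≤
      J * (ENNReal.ofReal (945 / 1000) * volume (Γ ∩ ball 0 1)) := by
    calc J * ∑ i, (C i).bend ((C i).params (B i))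
        ≤ ENNReal.ofReal (105 / 100) * ∑ i, ∫⁻ x in frontier Γ ∩ B i,
          ENNReal.ofReal (meanCurvature Γ x * f ‖x‖ ^ 2) ∂(μHE[2] : Measure E3) := by
          rw [Finset.mul_sum, Finset.mul_sum]
          exact Finset.sum_le_sum fun i _ => (C i).bend_mul_le_lintegral hsmooth hH (hBm i)
            (hBc i) (hBb i) hf.continuous.measurable
      _ ≤ ENNReal.ofReal (105 / 100) *
          (3 * volume (Γ ∩ ball 0 1) * (ENNReal.ofReal (3 / 10) * J)) :=
          mul_le_mul_right (h2.trans h1) _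
      _ = J * ((ENNReal.ofReal (105 / 100) * ENNReal.ofReal 3 * ENNReal.ofReal (3 / 10)) *
          volume (Γ ∩ ball 0 1)) := by
          rw [ENNReal.ofReal_ofNat]
          ring
      _ = _ := by
          rw [← ENNReal.ofReal_mul (by norm_num), ← ENNReal.ofReal_mul (by norm_num)]
          norm_num
  exact (ENNReal.mul_le_mul_iff_right hJ0 hJt).1 h3

/-- If the interior of the complement had two components, the tangent half planes of the boundary
would sweep out almost all of `Γ`. -/
lemma volume_le_sum_bend (hopen : IsOpen Γ) (hcone : IsCone Γ) (hne : Γ.Nonempty)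
    (hsmooth : HasSmoothBoundaryOffOrigin Γ)
    (hH : ∀ p ∈ frontier Γ, p ≠ 0 → 0 ≤ meanCurvature Γ p) {n : ℕ} {C : Fin n → BoundaryChart Γ}
    {B : Fin n → Set E3} (hBm : ∀ i, MeasurableSet (B i)) (hBc : ∀ i, IsCone (B i))
    (hBb : ∀ i, B i ⊆ (C i).box) (hcover : ∀ p ∈ frontier Γ, p ≠ 0 → ∃ i, p ∈ B i)
    {x₁ x₂ : E3} (hx₁ : x₁ ∈ interior Γᶜ) (hx₂ : x₂ ∈ interior Γᶜ)
    (h12 : x₂ ∉ connectedComponentIn (interior Γᶜ) x₁) :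
    volume (Γ ∩ ball 0 1) ≤
      ENNReal.ofReal (103 / 100) * ∑ i, (C i).bend ((C i).params (B i)) := by
  set U₁ := connectedComponentIn (interior Γᶜ) x₁ with hU₁
  set U₂ := connectedComponentIn (interior Γᶜ) x₂ with hU₂
  have hU₁o : IsOpen U₁ := isOpen_interior.connectedComponentIn
  have hU₂o : IsOpen U₂ := isOpen_interior.connectedComponentIn
  have hdisj : Disjoint U₁ U₂ := by
    by_contra h
    obtain ⟨y, hy1, hy2⟩ := Set.not_disjoint_iff.1 h
    refine h12 ?_
    rw [hU₁, connectedComponentIn_eq hy1, ← connectedComponentIn_eq hy2]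
    exact mem_connectedComponentIn hx₂
  have hU₁c : Convex ℝ U₁ := convex_connectedComponentIn hopen hcone hne
    (isLocallyConvexOffOrigin_compl hcone hsmooth hH) x₁
  have hnull : volume (-frontier U₁) = 0 := by
    rw [Measure.measure_neg]
    exact hU₁c.addHaar_frontier volume
  have hsweep : ∀ z ∈ interior Γᶜ, ∀ x ∈ Γ, -x ∉ closure (connectedComponentIn (interior Γᶜ) z) →
      ∃ i, x ∈ (C i).sweep ((C i).params (B i)) := by
    intro z hz x hx hxz
    obtain ⟨p, hp, hp0, h⟩ := exists_mem_sweep hopen hcone hne hsmooth hH hz hx hxz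
    obtain ⟨i, hi⟩ := hcover p hp hp0
    have hb := hBb i hi
    obtain ⟨t, ht, r, s, hs, e⟩ := h (C i) hb
    rw [mem_singleton_iff.1 ht] at e
    refine ⟨i, _, ⟨(C i).mem_Ioo_of_mem_box hb, ?_⟩, r, s, hs, e⟩
    rw [← (hBc i).smul_mem_iff hb.1, ← (C i).eq_smul_curve hb hp]
    exact hi
  have hsub : Γ ∩ ball 0 1 ⊆
      (⋃ i, (C i).sweep ((C i).params (B i)) ∩ ball 0 1) ∪ -frontier U₁ := by
    rintro x ⟨hx, hxb⟩
    by_cases hfr : -x ∈ frontier U₁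
    · exact Or.inr hfr
    left
    obtain ⟨i, hi⟩ : ∃ i, x ∈ (C i).sweep ((C i).params (B i)) := by
      by_cases h1 : -x ∈ closure U₁
      · refine hsweep x₂ hx₂ x hx fun h2 => ?_
        have h3 : -x ∈ U₁ := by
          by_contra h
          rw [hU₁o.frontier_eq] at hfr
          exact hfr ⟨h1, h⟩
        exact (hdisj.closure_right hU₁o).ne_of_mem h3 h2 rfl
      · exact hsweep x₁ hx₁ x hx h1
    exact mem_iUnion.2 ⟨i, hi, hxb⟩
  refine (measure_mono hsub).trans ((measure_union_le _ _).trans ?_)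
  rw [hnull, add_zero, Finset.mul_sum]
  refine (measure_iUnion_le _).trans ?_
  rw [tsum_fintype]
  exact Finset.sum_le_sum fun i _ => (C i).volume_sweep_inter_ball_le
    ((C i).measurableSet_params (hBm i)) ((C i).params_subset (B i))

/-- The interior of the complement of a stable cone has a single component: two components would
make the volume of `Γ` in the unit ball smaller than itself. -/
lemma connectedComponentIn_interior_compl_eq (hopen : IsOpen Γ) (hcone : IsCone Γ)
    (hne : Γ.Nonempty) (h0 : (0 : E3) ∉ Γ) (hsmooth : HasSmoothBoundaryOffOrigin Γ)
    (hH : ∀ p ∈ frontier Γ, p ≠ 0 → 0 ≤ meanCurvature Γ p) {c : ℝ}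
    (hstab : SatisfiesStabilityInequality c Γ) {x₁ : E3} (hx₁ : x₁ ∈ interior Γᶜ) :
    connectedComponentIn (interior Γᶜ) x₁ = interior Γᶜ := by
  refine (connectedComponentIn_subset _ _).antisymm fun x₂ hx₂ => ?_
  by_contra h12
  obtain ⟨n, C, B, hBm, hBc, hBb, hBd, hcover⟩ := exists_conical_partition hcone hsmooth
  have h1 := volume_le_sum_bend hopen hcone hne hsmooth hH hBm hBc hBb hcover hx₁ hx₂ h12
  have h2 := h1.trans (mul_le_mul_right
    (sum_bend_le hopen hcone h0 hsmooth hH hstab hBm hBc hBb hBd) _)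
  rw [← mul_assoc, ← ENNReal.ofReal_mul (by norm_num)] at h2
  have hfin : volume (Γ ∩ ball 0 1) ≠ ⊤ :=
    ((measure_mono inter_subset_right).trans_lt measure_ball_lt_top).ne
  have hpos : volume (Γ ∩ ball 0 1) ≠ 0 := by
    refine ((hopen.inter isOpen_ball).measure_pos volume ?_).ne'
    obtain ⟨z, hz1, hz2⟩ := mem_closure_iff.1 (hcone.zero_mem_closure hne) (ball 0 1) isOpen_ball
      (mem_ball_self one_pos)
    exact ⟨z, hz2, hz1⟩
  refine absurd h2 (not_le.2 ?_)
  calc _ < 1 * volume (Γ ∩ ball 0 1) := by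
        refine ENNReal.mul_lt_mul_left hpos hfin ?_
        rw [ENNReal.ofReal_lt_one]
        norm_num
    _ = _ := one_mul _

end Connectedness

theorem lemmal (c : ℝ) (hc : 0 ≤ c) (Γ : Set E3)
    (hopen : IsOpen Γ) (hcone : IsCone Γ)
    (hne : Γ.Nonempty) (hcompl : (Γᶜ \ {0}).Nonempty)
    (hsmooth : HasSmoothBoundaryOffOrigin Γ)
    (hH : ∀ p ∈ frontier Γ, p ≠ 0 → 0 ≤ meanCurvature Γ p)
    (hstab : SatisfiesStabilityInequality c Γ) :
    IsConnected (Γᶜ \ {0}) ∧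
      Convex ℝ Γᶜ ∧ IsCone Γᶜ ∧
      ∃ v : E3, v ≠ 0 ∧ ∀ x ∈ Γᶜ, 0 ≤ inner ℝ v x := by
  obtain ⟨q, hq, hq0⟩ := hcompl
  have h0 : (0 : E3) ∉ Γ := fun h =>
    hopen.isClosed_compl.closure_subset (hcone.compl.zero_mem_closure ⟨q, hq⟩) h
  have hdense := fun p => compl_subset_closure_interior hcone hsmooth (p := p)
  obtain ⟨x₁, hx₁⟩ : (interior Γᶜ).Nonempty := closure_nonempty_iff.1 ⟨q, hdense q hq hq0⟩
  have hU := connectedComponentIn_interior_compl_eq hopen hcone hne h0 hsmooth hH hstab hx₁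
  have hUconv : Convex ℝ (interior Γᶜ) := by
    rw [← hU]
    exact convex_connectedComponentIn hopen hcone hne
      (isLocallyConvexOffOrigin_compl hcone hsmooth hH) x₁
  have h0U := zero_notMem_interior_compl hcone hne
  have hcl : closure (interior Γᶜ) = Γᶜ := by
    refine (closure_minimal interior_subset hopen.isClosed_compl).antisymm fun p hp => ?_
    rcases eq_or_ne p 0 with rfl | hp0
    · exact hcone.compl.interior.zero_mem_closure ⟨x₁, hx₁⟩
    · exact hdense p hp hp0
  refine ⟨⟨⟨q, hq, hq0⟩, ?_⟩, ?_, hcone.compl, ?_⟩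
  · refine hUconv.isPreconnected.subset_closure (fun x hx => ⟨interior_subset hx, ?_⟩)
      (sdiff_subset.trans hcl.ge)
    rintro rfl
    exact h0U hx
  · rw [← hcl]
    exact hUconv.closure
  · obtain ⟨ν, hν, -, hνU⟩ := exists_normal_of_line isOpen_interior hUconv (x := 0)
      (fun s => by rwa [smul_zero]) ⟨x₁, hx₁⟩
    refine ⟨-ν, neg_ne_zero.2 hν, ?_⟩
    rw [← hcl]
    refine closure_minimal (t := {x | 0 ≤ ⟪-ν, x⟫}) (fun x hx => ?_)
      (isClosed_le continuous_const (by fun_prop))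
    rw [mem_ofPred_eq, inner_neg_left]
    exact neg_nonneg.2 (hνU x hx).le
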